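/- **Definitions.** All matroids are finite. Let $M$ be a matroid with ground set $E$, rank function $r$, and rank $r(M)$. $M$ is *connected* if any two distinct elements of $E$ lie in a common circuit; it is *uniform* if for some $k$ its independent sets are exactly the subsets of $E$ of size at most $k$. A flat $F$ is *proper* if $0<r(F)<r(M)$; a set is *cyclic* if it is a (possibly empty) union of circuits. A *certificate for non-splitting* is a proper cyclic flat $Z$ such that $M|Z$ and $M/Z$ are both connected and at least one of them is not uniform. Let $P(M)\subseteq\mathbb{R}^E$ be the convex hull of the characteristic vectors of the bases of $M$, and let $\Delta$ be the hypersimplex, i.e. the convex hull of all $0,1$-vectors in $\mathbb{R}^E$ with exactly $r(M)$ ones. For a flat $F$ put $H(F)=\{x\in\mathbb{R}^E:\sum_{i\in F}x_i=r(F)\}$. A *facet* of a polytope $P$ is a face $\neq P$ that is properly contained in no face other than $P$ (the empty set and $P$ count as faces). A *split* of a polytope $P$ is a collection $\mathcal{C}$ of polytopes such that: $\emptyset\in\mathcal{C}$; every vertex of a member of $\mathcal C$ is a vertex of $P$; all faces of members of $\mathcal{C}$ are in $\mathcal{C}$; the intersection of any two distinct members is a face of both; the union of $\mathcal{C}$ is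 $P$; and $\mathcal{C}$ has exactly two maximal members. The affine span of the intersection of these two maximal members is called a *split hyperplane* of $P$. A flat $F$ is a *flacet* of $M$ if $H(F)\cap P(M)$ is a facet of $P(M)$ and $F$ is inclusion-minimal among the flats $G$ with $H(G)\cap P(M)=H(F)\cap P(M)$. It is a *split flacet* if, in addition, the affine span of $H(F)\cap\Delta$ is a split hyperplane of $\Delta$. The matroid $M$ is *split* if for any two distinct split flacets $F_1,F_2$ of $M$ no point of $H(F_1)\cap H(F_2)$ lies in the relative interior of $A\cap[0,1]^E$, where $A$ is the affine span of $P(M)$. **Lemma.** Let $M$ be a connected matroid. 1. A subset $Z$ of the ground set is a split flacet of $M$ if and only if $Z$ is a proper cyclic flat of $M$ such that $M|Z$ and $M/Z$ are both connected. 2. $M$ is split if and only if it has no certificate for non-splitting. -/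

import Mathlib

open scoped Matroid

/-! ### Polytopes, their faces, and splits -/

section Polytopes

variable {V : Type*} [AddCommGroup V] [Module ℝ V] [TopologicalSpace V]

/-- A polytope is the convex hull of a finite set of points (the empty polytope is allowed). -/
def IsPolytope (P : Set V) : Prop := ∃ X : Set V, X.Finite ∧ P = convexHull ℝ X

/-- A facet of `P` is a face of `P` such that the only face properly containing it is `P` itself;
in particular it is different from `P`. Faces are Mathlib's exposed faces: the empty set, and the
sets of maximizers on `P` of a linear functional. -/
def IsFacet (P F : Set V) : Prop :=
  IsExposed ℝ P F ∧ F ≠ P ∧ ∀ G : Set V, IsExposed ℝ P G → F ⊂ G → G = P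

/-- A split of the polytope `P`: a polyhedral subdivision of `P` without new vertices that has
exactly two maximal cells. -/
structure IsPolytopeSplit (P : Set V) (C : Set (Set V)) : Prop where
  isPolytope : ∀ Q ∈ C, IsPolytope Q
  empty_mem : ∅ ∈ C
  vertices : ∀ Q ∈ C, Q.extremePoints ℝ ⊆ P.extremePoints ℝ
  face_mem : ∀ Q ∈ C, ∀ F : Set V, IsExposed ℝ Q F → F ∈ C
  inter : ∀ Q₁ ∈ C, ∀ Q₂ ∈ C, Q₁ ≠ Q₂ → IsExposed ℝ Q₁ (Q₁ ∩ Q₂) ∧ IsExposed ℝ Q₂ (Q₁ ∩ Q₂)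
  sUnion_eq : ⋃₀ C = P
  two_maximal : {Q | Maximal (· ∈ C) Q}.encard = 2

/-- A split hyperplane of `P` is the affine span of the intersection of the two maximal cells of
some split of `P`. -/
def IsSplitHyperplane (P : Set V) (S : AffineSubspace ℝ V) : Prop :=
  ∃ (C : Set (Set V)) (Q₁ Q₂ : Set V), IsPolytopeSplit P C ∧ Maximal (· ∈ C) Q₁ ∧ Maximal (· ∈ C) Q₂ ∧
    Q₁ ≠ Q₂ ∧ S = affineSpan ℝ (Q₁ ∩ Q₂)

end Polytopes

/-- The characteristic vector of a set. -/
noncomputable def charVec {ι : Type*} (B : Set ι) : ι → ℝ := B.indicator 1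

/-- The hypersimplex `Δ(r, ι)`: the convex hull of the `0,1`-vectors with exactly `r` ones. -/
def hypersimplex (r : ℕ) (ι : Type*) : Set (ι → ℝ) :=
  convexHull ℝ (charVec '' {B : Set ι | B.encard = r})

namespace Matroid

variable {α : Type*}

/-! ### Matroid notions -/

/-- A matroid is connected if any two distinct elements lie in a common circuit. -/
def IsConnected (M : Matroid α) : Prop :=
  ∀ e ∈ M.E, ∀ f ∈ M.E, e ≠ f → ∃ C, M.IsCircuit C ∧ e ∈ C ∧ f ∈ C

/-- A matroid is uniform if, for some `k`, its independent sets are exactly the subsets of the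
ground set with at most `k` elements. -/
def IsUniform (M : Matroid α) : Prop :=
  ∃ k : ℕ, ∀ I ⊆ M.E, M.Indep I ↔ I.encard ≤ k

/-- A proper flat is a flat `F` with `0 < r(F) < r(M)`. -/
def IsProperFlat (M : Matroid α) (F : Set α) : Prop :=
  M.IsFlat F ∧ 0 < M.eRk F ∧ M.eRk F < M.eRank

/-- A set is cyclic if it is a (possibly empty) union of circuits. -/
def IsCyclic (M : Matroid α) (F : Set α) : Prop :=
  ∃ S : Set (Set α), (∀ C ∈ S, M.IsCircuit C) ∧ F = ⋃₀ S

/-- A certificate for non-splitting. -/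
def IsCertificate (M : Matroid α) (Z : Set α) : Prop :=
  M.IsProperFlat Z ∧ M.IsCyclic Z ∧ (M ↾ Z).IsConnected ∧ (M ／ Z).IsConnected ∧
    (¬ (M ↾ Z).IsUniform ∨ ¬ (M ／ Z).IsUniform)

/-! ### The matroid polytope and split matroids

For a finite matroid `M` the ambient space is `ℝ^E`, that is `M.E → ℝ`. Ranks are read as natural
numbers through `ENat.toNat`, which loses nothing because `M` is finite. -/

/-- The matroid polytope: the convex hull of the characteristic vectors of the bases. -/
def polytope (M : Matroid α) : Set (M.E → ℝ) :=
  convexHull ℝ {x | ∃ B, M.IsBase B ∧ x = charVec ((↑) ⁻¹' B : Set M.E)}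

/-- The set `H(F)` of the points whose coordinates indexed by `F` add up to the rank of `F`. -/
def flatHyperplane (M : Matroid α) (F : Set α) : Set (M.E → ℝ) :=
  {x | ∑ᶠ e ∈ ((↑) ⁻¹' F : Set M.E), x e = ((M.eRk F).toNat : ℝ)}

/-- A flacet is a flat `F` for which `H(F)` meets the matroid polytope in a facet, and which is
inclusion-minimal among the flats that cut out this facet. -/
def IsFlacet (M : Matroid α) (F : Set α) : Prop :=
  Minimal (fun G => M.IsFlat G ∧
    M.flatHyperplane G ∩ M.polytope = M.flatHyperplane F ∩ M.polytope) F ∧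
  IsFacet M.polytope (M.flatHyperplane F ∩ M.polytope)

/-- A split flacet is a flacet `F` such that `H(F) ∩ Δ(r, E)` spans a split hyperplane of the
hypersimplex `Δ(r, E)`, where `r` is the rank of `M`. -/
def IsSplitFlacet (M : Matroid α) (F : Set α) : Prop :=
  M.IsFlacet F ∧ IsSplitHyperplane (hypersimplex M.eRank.toNat M.E)
    (affineSpan ℝ (M.flatHyperplane F ∩ hypersimplex M.eRank.toNat M.E))

/-- A split matroid: for any two distinct split flacets `F₁` and `F₂`, no point of
`H(F₁) ∩ H(F₂)` is in the relative interior of the intersection of the unit cube with the affine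
span of the matroid polytope. -/
def IsSplit (M : Matroid α) : Prop :=
  ∀ F₁ F₂, M.IsSplitFlacet F₁ → M.IsSplitFlacet F₂ → F₁ ≠ F₂ →
    ∀ x ∈ M.flatHyperplane F₁ ∩ M.flatHyperplane F₂,
      x ∉ intrinsicInterior ℝ ((affineSpan ℝ M.polytope : Set (M.E → ℝ)) ∩ Set.Icc 0 1)

end Matroid

/-! Everything combinatorial is stated through the rank function. The minor obtained from `M` by
restricting to `Y` and contracting `X` is encoded by the pair `X ⊆ Y`, so iterated minors stay
inside one function and their separations are handled by submodularity alone.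

Part 1. On the face `x(Z) = r(Z)` of the polytope lie the bases `I ∪ J` with `I` a basis of `M|Z`
and `J` a basis of `M/Z`. If both minors are connected, basis exchanges force every functional
constant on this face to be a combination of the coordinate sums over `Z` and `E \ Z`, so the face
is a facet. Conversely, a separation of either minor makes the facet coincide with the face of
another set, and a suitable base contradicts this (`rankConn_restrict_of_isFacet`,
`rankConn_contract_of_isFacet`). The hypersimplex is split by `x(Z) = r(Z)` once its vertices lie on
both sides, which the strict rank inequalities provide; the only facets to be excluded are those
with `Z` a single non-loop, where `x(Z) = 1` merely supports the hypersimplex.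

Part 2. The relative interior of the slice consists of the points of the open cube with coordinate
sum `r(M)`, as soon as there are two elements. If `M|Z` or `M/Z` is not uniform, that minor has a
set `W` for which restriction and contraction are again connected (`exists_conn_conn`). Either `W`,
or the set obtained from `W` by adding `E \ Z` or removing `Z`, is a second splitting set, and a
point constant on the three blocks of the resulting chain lies on both hyperplanes. If instead all
these minors are uniform, two splitting sets meet in an independent set and have a spanning union;
submodularity against the bounds `x(F₁ ∩ F₂) ≤ |F₁ ∩ F₂|` and `x(F₁ ∪ F₂) ≤ r(M)`, one of them
strict unless connectivity intervenes, excludes a common point (`not_isCommonPoint`). -/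

/-! ### Connectivity of rank functions -/

section RankFunction

variable {α : Type*}

/-- The properties of a matroid rank function on the subsets of a finite set `E`. -/
structure IsRankFunction (ρ : Set α → ℤ) (E : Set α) : Prop where
  finite : E.Finite
  empty : ρ ∅ = 0
  mono : ∀ ⦃A B : Set α⦄, A ⊆ B → ρ A ≤ ρ B
  submod : ∀ A B : Set α, ρ (A ∩ B) + ρ (A ∪ B) ≤ ρ A + ρ B
  le_ncard : ∀ A ⊆ E, ρ A ≤ A.ncard

/-- Connectivity of the minor on `Y \ X` obtained by restricting to `Y` and contracting `X`:
no separation of `Y` along `X`. -/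
def RankConn (ρ : Set α → ℤ) (X Y : Set α) : Prop :=
  ∀ A B : Set α, A ∩ B = X → A ∪ B = Y → A ≠ X → A ≠ Y → ρ X + ρ Y < ρ A + ρ B

/-- Uniformity of the minor obtained by restricting to `Y` and contracting `X`. -/
def RankUniform (ρ : Set α → ℤ) (X Y : Set α) : Prop :=
  ∀ S : Set α, X ⊆ S → S ⊆ Y → ρ S = ρ X + (S \ X).ncard ∨ ρ S = ρ Y

/-- The sets that turn out to be the split flacets of a connected matroid. -/
structure IsSplitting (ρ : Set α → ℤ) (E Z : Set α) : Prop where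
  subset : Z ⊆ E
  pos : 0 < ρ Z
  lt : ρ Z < ρ E
  lt_ncard : ρ Z < Z.ncard
  conn_restrict : RankConn ρ ∅ Z
  conn_contract : RankConn ρ Z E

variable {ρ : Set α → ℤ} {E X Y W A B S : Set α}

lemma IsSplitting.ne_ground (hZ : IsSplitting ρ E X) : X ≠ E := by
  rintro rfl
  exact hZ.lt.false

namespace IsRankFunction

lemma nonneg (h : IsRankFunction ρ E) (A : Set α) : 0 ≤ ρ A :=
  h.empty ▸ h.mono (Set.empty_subset A)

lemma union_le_add_ncard (h : IsRankFunction ρ E) (A : Set α) {T : Set α} (hT : T ⊆ E) :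
    ρ (A ∪ T) ≤ ρ A + T.ncard := by
  have := h.submod A T
  have := h.le_ncard T hT
  have := h.nonneg (A ∩ T)
  linarith

/-- Separations are inherited by restrictions, and in `sep_contract` by contractions: submodularity
for `A` and `S`, then once more to bring in `B`. -/
lemma sep_restrict (h : IsRankFunction ρ E) (hAB : A ∩ B = X) (hU : A ∪ B = Y)
    (hle : ρ A + ρ B ≤ ρ X + ρ Y) (hXS : X ⊆ S) (hSY : S ⊆ Y) :
    ρ (A ∩ S) + ρ (B ∩ S) ≤ ρ X + ρ S := by
  have h1 := h.submod A S
  have h2 := h.submod (A ∪ S) B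
  rw [show (A ∪ S) ∩ B = B ∩ S by grind, show A ∪ S ∪ B = Y by grind] at h2
  linarith

lemma sep_contract (h : IsRankFunction ρ E) (hAB : A ∩ B = X) (hU : A ∪ B = Y)
    (hle : ρ A + ρ B ≤ ρ X + ρ Y) (hXS : X ⊆ S) (hSY : S ⊆ Y) :
    ρ (A ∪ S) + ρ (B ∪ S) ≤ ρ S + ρ Y := by
  have h1 := h.submod A S
  have h2 := h.submod (A ∩ S) B
  rw [show A ∩ S ∩ B = X by grind, show A ∩ S ∪ B = B ∪ S by grind] at h2
  linarith

/-- A separation `(A, B)` induces one below `W` and one above `W`, both trivial by hypothesis. Hence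
`A` is one of `X`, `W`, `W'`, `Y`, and the strict inequality rules out the only nontrivial pair `W`,
`W'`. -/
lemma conn_trans (h : IsRankFunction ρ E) {W' : Set α} (hXW : RankConn ρ X W)
    (hWY : RankConn ρ W Y) (hX : W ∩ W' = X) (hY : W ∪ W' = Y)
    (hlt : ρ X + ρ Y < ρ W + ρ W') : RankConn ρ X Y := by
  intro A B hAB hU hAX hAY
  by_contra! hle
  have h1 := h.sep_restrict (S := W) hAB hU hle (by grind) (by grind)
  have h2 := h.sep_contract (S := W) hAB hU hle (by grind) (by grind)
  have h3 := hXW (A ∩ W) (B ∩ W) (by grind) (by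
    simp only [Set.ext_iff, Set.mem_inter_iff, Set.mem_union] at *; grind)
  have h4 := hWY (A ∪ W) (B ∪ W) (by
    simp only [Set.ext_iff, Set.mem_inter_iff, Set.mem_union] at *; grind) (by grind)
  by_cases c1 : A ∩ W = X
  · by_cases c2 : A ∪ W = W
    · exact hAX (by grind)
    · have c3 : A ∪ W = Y := by by_contra c3; linarith [h4 c2 c3]
      rw [show A = W' by
          simp only [Set.ext_iff, Set.mem_inter_iff, Set.mem_union] at *; grind, show B = W by
          simp only [Set.ext_iff, Set.mem_inter_iff, Set.mem_union] at *; grind] at hle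
      linarith
  · have c1' : A ∩ W = W := by by_contra c3; linarith [h3 c1 c3]
    by_cases c2 : A ∪ W = W
    · rw [show A = W by grind, show B = W' by
          simp only [Set.ext_iff, Set.mem_inter_iff, Set.mem_union] at *; grind] at hle
      linarith
    · have c3 : A ∪ W = Y := by by_contra c3; linarith [h4 c2 c3]
      exact hAY (by grind)

/-- The first term of a separation along `W` stays connected. -/
lemma conn_of_sep (h : IsRankFunction ρ E) (hXY : RankConn ρ X Y) (hXW : RankConn ρ X W)
    (hXW' : X ⊆ W) (hAB : A ∩ B = W) (hU : A ∪ B = Y) (hle : ρ A + ρ B ≤ ρ W + ρ Y) :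
    RankConn ρ X A := by
  -- A separation of `A` whose side `T` contains `W` extends to `Y` by gluing `B` to `T` along `W`.
  -- Connectivity of `W` ensures that one of the two sides contains `W`.
  have key : ∀ S T : Set α, S ∩ T = X → S ∪ T = A → S ≠ X → S ≠ A → W ⊆ T →
      ρ X + ρ A < ρ S + ρ T := by
    intro S T hST hSU hSX hSA hWT
    have h1 := h.submod T B
    rw [show T ∩ B = W by grind] at h1
    have h2 := hXY S (T ∪ B) (by grind) (by grind) hSX
      fun hSY ↦ hSA (by grind)
    linarith
  intro S T hST hSU hSX hSA
  by_contra! hle'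
  have h1 := h.sep_restrict (S := W) hST hSU hle' hXW' (by grind)
  have h2 := hXW (S ∩ W) (T ∩ W) (by grind) (by grind)
  by_cases c1 : S ∩ W = X
  · linarith [key S T hST hSU hSX hSA (by grind)]
  · have c2 : S ∩ W = W := by by_contra c3; linarith [h2 c1 c3]
    linarith [key T S (by grind) (by grind) (fun _ ↦ hSA (by grind))
      (fun _ ↦ hSX (by grind)) (by grind)]

/-- A connected non-uniform minor has a splitting set. -/
lemma exists_conn_conn (h : IsRankFunction ρ E) (hXY : RankConn ρ X Y) (hX : X ⊆ Y) (hY : Y ⊆ E)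
    (hU : ¬ RankUniform ρ X Y) :
    ∃ W, X ⊆ W ∧ W ⊆ Y ∧ RankConn ρ X W ∧ RankConn ρ W Y ∧ ρ X < ρ W ∧ ρ W < ρ Y ∧
      ρ W < ρ X + (W \ X).ncard ∧ ρ Y < ρ W + (Y \ W).ncard := by
  have hfin : {S : Set α | S ⊆ Y}.Finite := (h.finite.subset hY).finite_subsets
  -- In the minor, `p` says that the set is dependent and not spanning; such sets exist exactly when
  -- uniformity fails.
  let p : Set α → Prop := fun S ↦ X ⊆ S ∧ ρ S < ρ Y ∧ ρ S < ρ X + (S \ X).ncard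
  have hsub : ∀ q : Set α → Prop, {S | S ⊆ Y ∧ q S}.Finite := fun q ↦ hfin.subset fun _ hS ↦ hS.1
  have hp : ∃ S, S ⊆ Y ∧ p S := by
    simp only [RankUniform, not_forall, not_or] at hU
    obtain ⟨S, hXS, hSY, h1, h2⟩ := hU
    have h3 := h.union_le_add_ncard X (T := S \ X) (by grind)
    rw [Set.union_sdiff_cancel hXS] at h3
    exact ⟨S, hSY, hXS, lt_of_le_of_ne (h.mono hSY) h2, lt_of_le_of_ne h3 h1⟩
  -- A minimal such set is a circuit of the minor: its proper subsets are independent, so a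
  -- separation would make it independent too.
  have hmin : ∃ S, S ⊆ Y ∧ p S ∧ RankConn ρ X S := by
    obtain ⟨S, ⟨hSY, hXS, hS1, hS2⟩, hS⟩ := (hsub p).exists_minimal hp
    refine ⟨S, hSY, ⟨hXS, hS1, hS2⟩, ?_⟩
    have hind : ∀ T, X ⊆ T → T ⊆ S → T ≠ S → ρ X + (T \ X).ncard ≤ ρ T := by
      intro T hXT hTS hne
      by_contra! hlt
      exact hne (hTS.antisymm (hS ⟨hTS.trans hSY, hXT, (h.mono hTS).trans_lt hS1, hlt⟩ hTS))
    intro A B hAB hAB' hAX hAS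
    have hA := hind A (by grind) (by grind) hAS
    have hB := hind B (by grind) (by grind) fun hBS ↦ hAX (by grind)
    have hSfin := h.finite.subset (hSY.trans hY)
    have hc : (S \ X).ncard = (A \ X).ncard + (B \ X).ncard := by
      rw [← Set.ncard_union_eq (by rw [Set.disjoint_iff_inter_eq_empty]; grind)
        (hSfin.subset (by grind)) (hSfin.subset (by grind))]
      congr 1; grind
    rw [hc] at hS2
    push_cast at hS2
    linarith
  obtain ⟨W, ⟨hWY, ⟨hXW, hW1, hW2⟩, hWc⟩, hW⟩ :=
    (hsub fun S ↦ p S ∧ RankConn ρ X S).exists_maximal hmin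
  have hXneW : W ≠ X := by rintro rfl; simp at hW2
  have hWneY : W ≠ Y := by rintro rfl; simp at hW1
  have hsep := hXY W (X ∪ (Y \ W)) (by grind) (by grind) hXneW hWneY
  -- Both sides of a separation along the maximal `W` remain connected by `conn_of_sep` and
  -- dependent, so maximality makes both spanning; their ranks then add up to `2 ρ Y > ρ W + ρ Y`.
  have hWc' : RankConn ρ W Y := by
    have key : ∀ A B, A ∩ B = W → A ∪ B = Y → A ≠ W → ρ A + ρ B ≤ ρ W + ρ Y → ρ Y ≤ ρ A := by
      intro A B hAB hAB' hAW hle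
      by_contra! hlt
      have hWA : W ⊆ A := by grind
      have h1 := h.union_le_add_ncard W (T := A \ W) (by grind)
      have hAfin := h.finite.subset (show A ⊆ E by grind)
      have hc : (A \ X).ncard = (W \ X).ncard + (A \ W).ncard := by
        rw [← Set.ncard_union_eq (by rw [Set.disjoint_iff_inter_eq_empty]; grind)
          (hAfin.subset (by grind)) (hAfin.subset (by grind))]
        congr 1; grind
      rw [Set.union_sdiff_cancel hWA] at h1
      refine hAW (hWA.antisymm' (hW ⟨by grind, ⟨hXW.trans hWA, hlt, ?_⟩,
        h.conn_of_sep hXY hWc hXW hAB hAB' hle⟩ hWA))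
      rw [hc]; push_cast; linarith
    intro A B hAB hAB' hAW hAY
    by_contra! hle
    have hA := key A B hAB hAB' hAW hle
    have hB := key B A (by grind) (by grind) (fun _ ↦ hAY (by grind)) (by linarith)
    linarith
  have h1 := h.mono (show X ∪ (Y \ W) ⊆ Y by grind)
  have h2 := h.union_le_add_ncard X (T := Y \ W) (by grind)
  exact ⟨W, hXW, hWY, hWc, hWc', by linarith, hW1, hW2, by linarith⟩

end IsRankFunction
end RankFunction

/-! ### Common points of the hyperplanes of two splitting sets -/

section RankFunction

variable {α : Type*} {ρ : Set α → ℤ} {E X Y Z W A B S F F₁ F₂ : Set α}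

/-- `x` is a point with coordinates strictly between `0` and `1` satisfying `x(F) = ρ(F)` for
`F = F₁, F₂, E`. -/
def IsCommonPoint (ρ : Set α → ℤ) (E F₁ F₂ : Set α) (x : α → ℝ) : Prop :=
  (∀ e ∈ E, 0 < x e ∧ x e < 1) ∧ ∑ᶠ e ∈ F₁, x e = ρ F₁ ∧ ∑ᶠ e ∈ F₂, x e = ρ F₂ ∧
    ∑ᶠ e ∈ E, x e = ρ E

lemma exists_const_finsum_eq {m : ℤ} (hm : 0 < m) (hlt : m < S.ncard) :
    ∃ t : ℝ, 0 < t ∧ t < 1 ∧ ∑ᶠ _e ∈ S, t = m := by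
  have hS : (0 : ℝ) < S.ncard := by exact_mod_cast hm.trans hlt
  have hfin : S.Finite := Set.finite_of_ncard_pos (by exact_mod_cast hS)
  refine ⟨m / S.ncard, by positivity, ?_, ?_⟩
  · rw [div_lt_one hS]; exact_mod_cast hlt
  · rw [finsum_mem_eq_finite_toFinset_sum _ hfin, Finset.sum_const,
      ← Set.ncard_eq_toFinset_card S hfin, nsmul_eq_mul, mul_div_cancel₀ _ hS.ne']

/-- A point with prescribed sums on the parts of a three-part partition. -/
lemma exists_finsum_eq (hAB : A ⊆ B) {a b c : ℤ}
    (ha : 0 < a) (ha' : a < A.ncard) (hb : 0 < b) (hb' : b < (B \ A).ncard)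
    (hc : 0 < c) (hc' : c < (E \ B).ncard) :
    ∃ x : α → ℝ, (∀ e ∈ E, 0 < x e ∧ x e < 1) ∧ ∑ᶠ e ∈ A, x e = a ∧ ∑ᶠ e ∈ B \ A, x e = b ∧
      ∑ᶠ e ∈ E \ B, x e = c := by
  classical
  obtain ⟨s, hs, hs', hsum⟩ := exists_const_finsum_eq ha ha'
  obtain ⟨t, ht, ht', htsum⟩ := exists_const_finsum_eq hb hb'
  obtain ⟨u, hu, hu', husum⟩ := exists_const_finsum_eq hc hc'
  refine ⟨fun e ↦ if e ∈ A then s else if e ∈ B then t else u, ?_, ?_, ?_, ?_⟩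
  · intro e _
    dsimp only
    split_ifs <;> simp [*]
  · rw [← hsum]; exact finsum_mem_congr rfl fun e he ↦ by simp [he]
  · rw [← htsum]; exact finsum_mem_congr rfl fun e he ↦ by simp [he.1, he.2]
  · rw [← husum]
    exact finsum_mem_congr rfl fun e he ↦ by simp [he.2, show e ∉ A from fun h ↦ he.2 (hAB h)]

lemma finsum_mem_eq_add_diff {x : α → ℝ} (hE : E.Finite) (hAB : A ⊆ B) (hBE : B ⊆ E) :
    ∑ᶠ e ∈ B, x e = ∑ᶠ e ∈ A, x e + ∑ᶠ e ∈ B \ A, x e :=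
  (finsum_mem_add_sdiff hAB (hE.subset hBE)).symm

namespace IsRankFunction

lemma ncard_add_ncard_diff (h : IsRankFunction ρ E) (hAB : A ⊆ B) (hBE : B ⊆ E) :
    (B.ncard : ℤ) = A.ncard + (B \ A).ncard := by
  have := Set.ncard_sdiff_add_ncard_of_subset hAB (h.finite.subset hBE)
  omega

lemma le_add_ncard_diff (h : IsRankFunction ρ E) (hAB : A ⊆ B) (hBE : B ⊆ E) :
    ρ B ≤ ρ A + (B \ A).ncard := by
  have := h.union_le_add_ncard A (T := B \ A) (by grind)
  rwa [Set.union_sdiff_cancel hAB] at this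

/-- Splitting sets are flats: a set of the same rank above `Z` would consist of loops of the
contraction and split off from it. -/
lemma lt_of_ssubset (h : IsRankFunction ρ E) (hZ : IsSplitting ρ E Z) (hZS : Z ⊆ S)
    (hSE : S ⊆ E) (hne : S ≠ Z) : ρ Z < ρ S := by
  by_contra! hle
  have h1 := hZ.lt
  have h2 := hZ.conn_contract S (Z ∪ (E \ S)) (by grind) (by grind) hne
    (by rintro rfl; linarith)
  have h3 := h.mono (show Z ∪ (E \ S) ⊆ E by have := hZ.subset; grind)
  linarith

lemma exists_commonPoint_of_not_uniform_restrict (h : IsRankFunction ρ E)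
    (hE : RankConn ρ ∅ E) (hZ : IsSplitting ρ E Z) (hU : ¬ RankUniform ρ ∅ Z) :
    ∃ F x, IsSplitting ρ E F ∧ F ≠ Z ∧ IsCommonPoint ρ E F Z x := by
  obtain ⟨hZE, hZ0, hZ1, hZ2, hZc, hZc'⟩ := hZ
  obtain ⟨F, -, hFZ, hFc, hFc', hF0, hF1, hF2, hF3⟩ :=
    h.exists_conn_conn hZc (Set.empty_subset Z) hZE hU
  rw [Set.sdiff_empty] at hF2
  rw [h.empty] at hF0 hF2
  have hFE := hFZ.trans hZE
  have hsep : ρ E < ρ Z + ρ (E \ Z) := by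
    have := hE Z (E \ Z) (by grind) (by grind) (by rintro rfl; linarith [h.empty])
      (by rintro rfl; linarith)
    linarith [h.empty]
  have hEZ := h.le_ncard (E \ Z) (by grind)
  -- The block sums are the rank jumps along `F ⊆ Z ⊆ E`; each is positive and smaller than its
  -- block, so the constants lie strictly between `0` and `1`.
  obtain ⟨x, hx, hxF, hxZ, hxE⟩ := exists_finsum_eq (E := E) hFZ (a := ρ F) (b := ρ Z - ρ F)
    (c := ρ E - ρ Z) hF0 (by linarith) (by linarith) (by linarith) (by linarith) (by linarith)
  have hxZ' : ∑ᶠ e ∈ Z, x e = ρ Z := by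
    rw [finsum_mem_eq_add_diff h.finite hFZ hZE, hxF, hxZ]; push_cast; ring
  have hxE' : ∑ᶠ e ∈ E, x e = ρ E := by
    rw [finsum_mem_eq_add_diff h.finite hZE subset_rfl, hxE, hxZ']; push_cast; ring
  set F' := F ∪ (E \ Z) with hF'
  by_cases hlt : ρ F + ρ E < ρ Z + ρ F'
  · refine ⟨F, x, ⟨hFE, hF0, hF1.trans hZ1, by linarith, hFc, ?_⟩, by rintro rfl; linarith,
      hx, hxF, hxZ', hxE'⟩
    exact h.conn_trans hFc' hZc' (W' := F') (by grind) (by grind) hlt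
  -- Contracting `F` now gives the direct sum of the minors on `Z \ F` and `E \ Z`. The minor on `F'
  -- \ F` is the connected contraction of `Z`, the contraction of `F'` is the connected minor on `Z
  -- \ F`, and `ρ F' = ρ F + ρ E - ρ Z` keeps `x` on the hyperplane.
  · push Not at hlt
    have hF'E : F' ⊆ E := by grind
    have hge := h.submod F' Z
    rw [show F' ∩ Z = F by grind, show F' ∪ Z = E by grind] at hge
    have hFF' := h.mono (show F ⊆ F' by grind)
    have hdiff : F' \ F = E \ Z := by grind
    have hcard := h.ncard_add_ncard_diff (show F ⊆ F' by grind) hF'E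
    have hle := h.le_add_ncard_diff (show F ⊆ F' by grind) hF'E
    have hEne : (E \ Z).Nonempty := by
      by_contra! he
      rw [he, h.empty] at hsep
      linarith
    refine ⟨F', x, ⟨hF'E, by linarith, by linarith, by linarith, ?_, ?_⟩, ?_, hx, ?_, hxZ', hxE'⟩
    · refine h.conn_trans hFc (W := F) (W' := E \ Z) ?_ (by grind) rfl (by linarith [h.empty])
      intro A B hAB hU hAF hAF'
      have h1 := hZc' (A ∪ Z) (B ∪ Z) (by grind) (by grind) (by grind) (by grind)
      have h2 := h.submod A Z
      have h3 := h.submod B Z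
      rw [show A ∩ Z = F by grind] at h2
      rw [show B ∩ Z = F by grind] at h3
      linarith
    · intro A B hAB hU hAF hAF'
      have h1 := hFc' (A ∩ Z) (B ∩ Z) (by grind) (by grind) (by grind) (by grind)
      have h2 := h.submod A Z
      have h3 := h.submod B Z
      rw [show A ∪ Z = E by grind] at h2
      rw [show B ∪ Z = E by grind] at h3
      linarith
    · rintro he
      obtain ⟨e, he⟩ := hEne
      grind
    · rw [finsum_mem_eq_add_diff h.finite (show F ⊆ F' by grind) hF'E, hdiff, hxF, hxE]
      have : ρ F' = ρ F + (ρ E - ρ Z) := by linarith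
      rw [this]; push_cast; ring

/-- Dual to the restriction case, with `F` above `Z`: the second splitting set is `F`, or `F \ Z`
when the restriction to `F` is the direct sum of those to `Z` and `F \ Z`. -/
lemma exists_commonPoint_of_not_uniform_contract (h : IsRankFunction ρ E)
    (hE : RankConn ρ ∅ E) (hZ : IsSplitting ρ E Z) (hU : ¬ RankUniform ρ Z E) :
    ∃ F x, IsSplitting ρ E F ∧ F ≠ Z ∧ IsCommonPoint ρ E F Z x := by
  obtain ⟨hZE, hZ0, hZ1, hZ2, hZc, hZc'⟩ := hZ
  obtain ⟨F, hZF, hFE, hFc, hFc', hF0, hF1, hF2, hF3⟩ :=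
    h.exists_conn_conn hZc' hZE subset_rfl hU
  have hsep : ρ E < ρ Z + ρ (E \ Z) := by
    have := hE Z (E \ Z) (by grind) (by grind) (by rintro rfl; linarith [h.empty])
      (by rintro rfl; linarith)
    linarith [h.empty]
  obtain ⟨x, hx, hxZ, hxF, hxE⟩ := exists_finsum_eq (E := E) hZF (a := ρ Z) (b := ρ F - ρ Z)
    (c := ρ E - ρ F) hZ0 hZ2 (by linarith) (by linarith) (by linarith) (by linarith)
  have hxF' : ∑ᶠ e ∈ F, x e = ρ F := by
    rw [finsum_mem_eq_add_diff h.finite hZF hFE, hxZ, hxF]; push_cast; ring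
  have hxE' : ∑ᶠ e ∈ E, x e = ρ E := by
    rw [finsum_mem_eq_add_diff h.finite hFE subset_rfl, hxE, hxF']; push_cast; ring
  have hcard := h.ncard_add_ncard_diff hZF hFE
  by_cases hlt : ρ F < ρ Z + ρ (F \ Z)
  · refine ⟨F, x, ⟨hFE, by linarith, hF1, by linarith, ?_, hFc'⟩, by rintro rfl; linarith,
      hx, hxF', hxZ, hxE'⟩
    exact h.conn_trans hZc hFc (W' := F \ Z) (by grind) (by grind) (by linarith [h.empty])
  · push Not at hlt
    have hge := h.submod (F \ Z) Z
    rw [show F \ Z ∩ Z = ∅ by grind, show F \ Z ∪ Z = F by grind, h.empty] at hge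
    have hne : Z.Nonempty := by
      by_contra! he
      rw [he, h.empty] at hZ0
      linarith
    set F' := F \ Z with hF'
    refine ⟨F', x, ⟨by grind, by linarith, by linarith, by linarith, ?_, ?_⟩, ?_, hx, ?_,
      hxZ, hxE'⟩
    · intro A B hAB hU hAF hAF'
      have h1 := hFc (A ∪ Z) (B ∪ Z) (by
          simp only [Set.ext_iff, Set.mem_inter_iff, Set.mem_union, Set.mem_sdiff] at *; grind) (by
          simp only [Set.ext_iff, Set.mem_inter_iff, Set.mem_union, Set.mem_sdiff] at *; grind) (by
          simp only [Set.ext_iff, Set.mem_inter_iff, Set.mem_union, Set.mem_sdiff] at *; grind)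
        (by grind)
      have h2 := h.submod A Z
      have h3 := h.submod B Z
      rw [show A ∩ Z = ∅ by
          simp only [Set.ext_iff, Set.mem_inter_iff, Set.mem_union, Set.mem_sdiff] at *
          grind, h.empty] at h2
      rw [show B ∩ Z = ∅ by
          simp only [Set.ext_iff, Set.mem_inter_iff, Set.mem_union, Set.mem_sdiff] at *
          grind, h.empty] at h3
      linarith [h.empty]
    · refine h.conn_trans (W := F) (W' := E \ Z) ?_ hFc' (by grind) (by grind) (by linarith)
      intro A B hAB hU hAF hAF'
      have h1 := hZc (A ∩ Z) (B ∩ Z) (by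
          simp only [Set.ext_iff, Set.mem_inter_iff, Set.mem_union, Set.mem_sdiff] at *
          grind) (by grind)
        (fun he ↦ hAF (by
          simp only [Set.ext_iff, Set.mem_inter_iff, Set.mem_union, Set.mem_sdiff,
            Set.mem_empty_iff_false] at *
          grind))
        (by simp only [Set.ext_iff, Set.mem_inter_iff, Set.mem_union, Set.mem_sdiff] at *; grind)
      have h2 := h.submod A Z
      have h3 := h.submod B Z
      rw [show A ∪ Z = F by
          simp only [Set.ext_iff, Set.mem_inter_iff, Set.mem_union, Set.mem_sdiff] at *
          grind] at h2
      rw [show B ∪ Z = F by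
          simp only [Set.ext_iff, Set.mem_inter_iff, Set.mem_union, Set.mem_sdiff] at *
          grind] at h3
      linarith [h.empty]
    · rintro he
      obtain ⟨e, he⟩ := hne
      grind
    · have h1 := finsum_mem_eq_add_diff (x := x) h.finite hZF hFE
      rw [hxF', hxZ] at h1
      have : ρ F' = ρ F - ρ Z := by linarith
      rw [this]; push_cast; linarith

lemma finsum_mem_le_of_subset {x : α → ℝ} (hE : E.Finite) (hx : ∀ e ∈ E, 0 < x e ∧ x e < 1)
    (hAB : A ⊆ B) (hBE : B ⊆ E) :
    ∑ᶠ e ∈ A, x e ≤ ∑ᶠ e ∈ B, x e ∧ (A ≠ B → ∑ᶠ e ∈ A, x e < ∑ᶠ e ∈ B, x e) := by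
  rw [finsum_mem_eq_finite_toFinset_sum _ ((hE.subset hBE).subset hAB),
    finsum_mem_eq_finite_toFinset_sum _ (hE.subset hBE)]
  have hsub : ((hE.subset hBE).subset hAB).toFinset ⊆ (hE.subset hBE).toFinset := by
    simpa using hAB
  refine ⟨Finset.sum_le_sum_of_subset_of_nonneg hsub fun i hi _ ↦
    (hx i (hBE (by simpa using hi))).1.le, fun hne ↦ ?_⟩
  obtain ⟨e, heB, heA⟩ := Set.exists_of_ssubset (hAB.ssubset_of_ne hne)
  exact Finset.sum_lt_sum_of_subset hsub (i := e) (by simpa using heB) (by simpa using heA)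
    (hx e (hBE heB)).1 fun i hi _ ↦ (hx i (hBE (by simpa using hi))).1.le

lemma finsum_mem_lt_ncard {x : α → ℝ} (hE : E.Finite) (hx : ∀ e ∈ E, 0 < x e ∧ x e < 1)
    (hA : A.Nonempty) (hAE : A ⊆ E) : ∑ᶠ e ∈ A, x e < A.ncard := by
  rw [finsum_mem_eq_finite_toFinset_sum _ (hE.subset hAE),
    Set.ncard_eq_toFinset_card _ (hE.subset hAE), Finset.cast_card]
  refine Finset.sum_lt_sum_of_nonempty (by simpa using hA) fun i hi ↦ (hx i (hAE ?_)).2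
  simpa using hi

/-- If all splitting sets have uniform restriction and contraction, then no point of the open cube
is common to the hyperplanes of two of them. -/
lemma not_isCommonPoint (h : IsRankFunction ρ E) (hE : RankConn ρ ∅ E)
    (h₁ : IsSplitting ρ E F₁) (h₂ : IsSplitting ρ E F₂) (hne : F₁ ≠ F₂)
    (hU₁ : RankUniform ρ ∅ F₁) (hU₁' : RankUniform ρ F₁ E) (hU₂ : RankUniform ρ ∅ F₂)
    (x : α → ℝ) : ¬ IsCommonPoint ρ E F₁ F₂ x := by
  rintro ⟨hx, hx₁, hx₂, hxE⟩
  have hinc : ∀ F G, IsSplitting ρ E F → IsSplitting ρ E G → F ≠ G → RankUniform ρ ∅ G →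
      ¬ F ⊆ G := by
    intro F G hF hG hFG hU hsub
    have h1 := h.lt_of_ssubset hF hsub hG.subset hFG.symm
    have h2 := hF.lt_ncard
    rcases hU F (Set.empty_subset F) hsub with h3 | h3
    · rw [Set.sdiff_empty, h.empty] at h3; linarith
    · linarith
  have h12 := hinc F₁ F₂ h₁ h₂ hne hU₂
  have h21 := hinc F₂ F₁ h₂ h₁ hne.symm hU₁
  have hsub : F₁ ∪ F₂ ⊆ E := Set.union_subset h₁.subset h₂.subset
  have hsm := h.submod F₁ F₂
  -- Otherwise the intersection spans `F₁`, and submodularity gives `F₁ ∪ F₂` the rank of the flat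
  -- `F₂`.
  have hI : ρ (F₁ ∩ F₂) = (F₁ ∩ F₂).ncard := by
    rcases hU₁ (F₁ ∩ F₂) (Set.empty_subset _) Set.inter_subset_left with h3 | h3
    · rwa [Set.sdiff_empty, h.empty, zero_add] at h3
    · have := h.lt_of_ssubset h₂ (Set.subset_union_right (s := F₁)) hsub
        (fun he ↦ h12 (he ▸ Set.subset_union_left))
      linarith
  have hne₁ : F₁ ≠ ∅ := by rintro rfl; exact h12 (Set.empty_subset _)
  -- Otherwise `F₂ \ F₁` is independent after contracting `F₁`, and submodularity makes `F₂`
  -- independent.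
  have hspan : ρ (F₁ ∪ F₂) = ρ E := by
    rcases hU₁' (F₁ ∪ F₂) Set.subset_union_left hsub with h3 | h3
    · exfalso
      rw [Set.union_sdiff_left] at h3
      have hcard := h.ncard_add_ncard_diff (A := F₁ ∩ F₂) Set.inter_subset_right h₂.subset
      rw [show F₂ \ (F₁ ∩ F₂) = F₂ \ F₁ by grind] at hcard
      have hl := h₂.lt_ncard
      rcases (F₁ ∩ F₂).eq_empty_or_nonempty with h4 | h4
      · rw [h4, Set.ncard_empty] at hcard
        rw [h4, h.empty] at hsm
        push_cast at hcard
        linarith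
      · have h5 := h₂.conn_restrict (F₁ ∩ F₂) (F₂ \ F₁) (by grind) (by grind) h4.ne_empty
          (by grind)
        have h6 := h.le_ncard (F₂ \ F₁) (by have := h₂.subset; grind)
        linarith [h.empty]
    · exact h3
  have hsum : ∑ᶠ e ∈ F₁ ∪ F₂, x e + ∑ᶠ e ∈ F₁ ∩ F₂, x e = ρ F₁ + ρ F₂ := by
    rw [finsum_mem_union_inter (h.finite.subset h₁.subset) (h.finite.subset h₂.subset), hx₁, hx₂]
  have hle := finsum_mem_le_of_subset h.finite hx hsub subset_rfl
  rw [hxE] at hle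
  have hsm' : (ρ (F₁ ∩ F₂) : ℝ) + ρ (F₁ ∪ F₂) ≤ ρ F₁ + ρ F₂ := by exact_mod_cast hsm
  rw [hI, hspan] at hsm'
  push_cast at hsm'
  -- Strictness comes from the intersection if it is nonempty, from an element outside the union if
  -- there is one, and otherwise from connectivity: `ρ E < ρ F₁ + ρ F₂`.
  rcases (F₁ ∩ F₂).eq_empty_or_nonempty with h4 | h4
  · rw [h4] at hsum hsm'
    simp only [finsum_mem_empty, Set.ncard_empty] at hsum hsm'
    by_cases h5 : F₁ ∪ F₂ = E
    · have h6 := hE F₁ F₂ h4 h5 hne₁ (by grind)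
      rw [h5, hxE, h.empty] at *
      have : (ρ E : ℝ) < ρ F₁ + ρ F₂ := by exact_mod_cast (by linarith : ρ E < ρ F₁ + ρ F₂)
      linarith
    · have := hle.2 h5
      push_cast at hsm'
      linarith
  · have := finsum_mem_lt_ncard h.finite hx h4 (Set.inter_subset_left.trans h₁.subset)
    linarith [hle.1]

end IsRankFunction
end RankFunction

/-! ### Integer ranks of finite matroids -/

namespace Matroid

variable {α : Type*} {M : Matroid α} {A B C C₁ C₂ I J X Y Z : Set α} {e f : α}

/-- The rank of a set as an integer. -/
noncomputable def intRk (M : Matroid α) (A : Set α) : ℤ := (M.eRk A).toNat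

lemma IsBasis'.intRk_eq (h : M.IsBasis' I A) : M.intRk A = I.ncard := by
  rw [intRk, h.eRk_eq_encard, Set.ncard]

lemma IsBasis.intRk_eq (h : M.IsBasis I A) : M.intRk A = I.ncard := h.isBasis'.intRk_eq

lemma Indep.intRk_eq (h : M.Indep I) : M.intRk I = I.ncard := h.isBasis_self.intRk_eq

lemma IsBase.intRk_ground (h : M.IsBase B) : M.intRk M.E = B.ncard := h.isBasis_ground.intRk_eq

lemma eRk_lt_eRk_iff [M.RankFinite] : M.eRk A < M.eRk B ↔ M.intRk A < M.intRk B := by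
  obtain ⟨m, hm⟩ := ENat.ne_top_iff_exists.1 (show M.eRk A ≠ ⊤ by simp [eRk_eq_top_iff])
  obtain ⟨n, hn⟩ := ENat.ne_top_iff_exists.1 (show M.eRk B ≠ ⊤ by simp [eRk_eq_top_iff])
  simp [intRk, ← hm, ← hn]

lemma eRk_le_eRk_iff [M.RankFinite] : M.eRk A ≤ M.eRk B ↔ M.intRk A ≤ M.intRk B := by
  rw [← not_lt, eRk_lt_eRk_iff, not_lt]

lemma isRankFunction (M : Matroid α) [M.Finite] : IsRankFunction M.intRk M.E where
  finite := M.ground_finite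
  empty := by simp [intRk]
  mono A B hAB := eRk_le_eRk_iff.1 (M.eRk_mono hAB)
  submod A B := by
    have h := M.eRk_inter_add_eRk_union_le A B
    have hA : ∀ S, M.eRk S ≠ ⊤ := fun S ↦ by simp [eRk_eq_top_iff]
    have := ENat.toNat_le_toNat h (by simp [hA])
    rw [ENat.toNat_add (hA _) (hA _), ENat.toNat_add (hA _) (hA _)] at this
    simp only [intRk]
    exact_mod_cast this
  le_ncard A hA := by
    obtain ⟨I, hI⟩ := M.exists_isBasis A
    rw [hI.intRk_eq]
    exact_mod_cast Set.ncard_le_ncard hI.subset (M.ground_finite.subset hA)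

lemma Indep.ncard_le_intRk [M.Finite] (h : M.Indep I) (hIA : I ⊆ A) : (I.ncard : ℤ) ≤ M.intRk A :=
  h.intRk_eq ▸ M.isRankFunction.mono hIA

lemma indep_of_ncard_le_intRk [M.Finite] (hA : A ⊆ M.E) (h : (A.ncard : ℤ) ≤ M.intRk A) :
    M.Indep A := by
  obtain ⟨I, hI⟩ := M.exists_isBasis A
  rw [hI.intRk_eq] at h
  rw [← Set.eq_of_subset_of_ncard_le hI.subset (by exact_mod_cast h) (M.ground_finite.subset hA)]
  exact hI.indep

lemma Indep.isBase_of_intRk_le [M.Finite] (h : M.Indep I) (hle : M.intRk M.E ≤ I.ncard) :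
    M.IsBase I := by
  obtain ⟨B, hB, hIB⟩ := h.exists_isBase_superset
  rw [hB.intRk_ground] at hle
  rwa [Set.eq_of_subset_of_ncard_le hIB (by exact_mod_cast hle) hB.finite]

/-! ### Connectivity through circuits and through ranks -/

/-- Transitivity of lying in a common circuit, by induction on the size of the union. Strong
elimination of a common element `g` yields `C₃` through `e` and `C₄` through `f`. Either `C₁ ∪ C₄`
is smaller, or `C₃` and `C₄` meet and their union misses `g`. -/
lemma IsCircuit.exists_isCircuit_of_inter [M.Finite] (hC₁ : M.IsCircuit C₁) (hC₂ : M.IsCircuit C₂)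
    (he : e ∈ C₁) (hf : f ∈ C₂) (hne : (C₁ ∩ C₂).Nonempty) :
    ∃ C, M.IsCircuit C ∧ e ∈ C ∧ f ∈ C := by
  induction hn : (C₁ ∪ C₂).ncard using Nat.strong_induction_on generalizing C₁ C₂ with
  | _ n ih =>
  subst hn
  by_cases heC₂ : e ∈ C₂
  · exact ⟨C₂, hC₂, heC₂, hf⟩
  by_cases hfC₁ : f ∈ C₁
  · exact ⟨C₁, hC₁, he, hfC₁⟩
  obtain ⟨g, hg₁, hg₂⟩ := hne
  have hfin : (C₁ ∪ C₂).Finite := hC₁.finite.union hC₂.finite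
  obtain ⟨C₃, hC₃ss, hC₃, heC₃⟩ := hC₁.strong_elimination hC₂ hg₁ hg₂ he heC₂
  obtain ⟨C₄, hC₄ss, hC₄, hfC₄⟩ := hC₂.strong_elimination hC₁ hg₂ hg₁ hf hfC₁
  obtain ⟨a, ha₃, ha₁⟩ : ∃ a ∈ C₃, a ∉ C₁ := by
    by_contra! hss
    exact (hC₃ss (hC₃.eq_of_subset_isCircuit hC₁ hss ▸ hg₁)).2 rfl
  obtain ⟨b, hb₄, hb₂⟩ : ∃ b ∈ C₄, b ∉ C₂ := by
    by_contra! hss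
    exact (hC₄ss (hC₄.eq_of_subset_isCircuit hC₂ hss ▸ hg₂)).2 rfl
  have ha₂ : a ∈ C₂ := (hC₃ss ha₃).1.resolve_left ha₁
  have hb₁ : b ∈ C₁ := (hC₄ss hb₄).1.resolve_left hb₂
  by_cases h41 : C₁ ∪ C₄ = C₁ ∪ C₂
  · have ha₄ : a ∈ C₄ := by
      have : a ∈ C₁ ∪ C₄ := h41 ▸ Or.inr ha₂
      exact this.resolve_left ha₁
    refine ih _ ?_ hC₃ hC₄ heC₃ hfC₄ ⟨a, ha₃, ha₄⟩ rfl
    refine Set.ncard_lt_ncard ⟨by grind, fun hss ↦ ?_⟩ hfin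
    have := hss (Or.inl hg₁)
    grind
  · refine ih _ ?_ hC₁ hC₄ he hfC₄ ⟨b, hb₁, hb₄⟩ rfl
    exact Set.ncard_lt_ncard (LE.le.ssubset_of_ne (by grind) h41) hfin

/-- A circuit crossing a separation has independent traces whose sizes add up to its rank, so it
would be independent. Conversely, if the class of `e` is proper, bases of it and of its complement
have a dependent union, and a circuit therein crosses the class. -/
lemma isConnected_iff_rankConn (M : Matroid α) [M.Finite] :
    M.IsConnected ↔ RankConn M.intRk ∅ M.E := by
  have hM := M.isRankFunction
  refine ⟨fun h A B hAB hU hA hAE ↦ ?_, fun h e he f hf hne ↦ ?_⟩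
  · by_contra! hle
    obtain ⟨a, ha⟩ := Set.nonempty_iff_ne_empty.2 hA
    obtain ⟨b, hbE, hbA⟩ := Set.exists_of_ssubset
      ((show A ⊆ M.E from hU ▸ Set.subset_union_left).ssubset_of_ne hAE)
    obtain ⟨C, hC, haC, hbC⟩ := h a (hU ▸ Or.inl ha) b hbE (by rintro rfl; exact hbA ha)
    have h1 := hM.sep_restrict hAB hU hle (Set.empty_subset C) hC.subset_ground
    have hbB : b ∈ B := by rw [← hU] at hbE; exact hbE.resolve_left hbA
    have hA' : M.Indep (A ∩ C) := hC.ssubset_indep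
      ⟨Set.inter_subset_right, fun hss ↦ hbA (hss hbC).1⟩
    have hB' : M.Indep (B ∩ C) := hC.ssubset_indep
      ⟨Set.inter_subset_right, fun hss ↦ by
        have : a ∈ A ∩ B := ⟨ha, (hss haC).1⟩
        simp [hAB] at this⟩
    rw [hA'.intRk_eq, hB'.intRk_eq, hM.empty, zero_add] at h1
    refine hC.not_indep (indep_of_ncard_le_intRk hC.subset_ground (le_trans ?_ h1))
    rw [← Nat.cast_add, Nat.cast_le]
    refine le_trans (le_of_eq ?_) (Set.ncard_union_le _ _)
    rw [← Set.union_inter_distrib_right, hU, Set.inter_eq_right.2 hC.subset_ground]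
  · by_contra hef
    set K : Set α := {x ∈ M.E | x = e ∨ ∃ C, M.IsCircuit C ∧ e ∈ C ∧ x ∈ C} with hK
    have hfK : f ∉ K := by
      rintro ⟨-, rfl | h'⟩
      · exact hne rfl
      · exact hef h'
    have heK : e ∈ K := ⟨he, Or.inl rfl⟩
    have hKE : K ⊆ M.E := fun _ hx ↦ hx.1
    have hlt := h K (M.E \ K) (by grind) (by grind) (Set.nonempty_iff_ne_empty.1 ⟨e, heK⟩)
      (fun hKE ↦ hfK (hKE ▸ hf))
    obtain ⟨I, hI⟩ := M.exists_isBasis K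
    obtain ⟨J, hJ⟩ := M.exists_isBasis (M.E \ K)
    have hdj : Disjoint I J := Set.disjoint_left.2 fun x hxI hxJ ↦ (hJ.subset hxJ).2 (hI.subset hxI)
    have hIJ : ¬ M.Indep (I ∪ J) := by
      intro hi
      have := hi.ncard_le_intRk hi.subset_ground
      rw [Set.ncard_union_eq hdj hI.indep.finite hJ.indep.finite] at this
      rw [hI.intRk_eq, hJ.intRk_eq, hM.empty] at hlt
      push_cast at this
      linarith
    obtain ⟨C, hCss, hC⟩ := (M.not_indep_iff (Set.union_subset hI.indep.subset_ground
      hJ.indep.subset_ground)).1 hIJ |>.exists_isCircuit_subset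
    obtain ⟨a, haC, haJ⟩ : ∃ a ∈ C, a ∉ J := by
      by_contra! hss
      exact hC.not_indep (hJ.indep.subset hss)
    obtain ⟨b, hbC, hbI⟩ : ∃ b ∈ C, b ∉ I := by
      by_contra! hss
      exact hC.not_indep (hI.indep.subset hss)
    have haK := hI.subset ((hCss haC).resolve_right haJ)
    have hbK := hJ.subset ((hCss hbC).resolve_left hbI)
    refine hbK.2 ⟨hbK.1, Or.inr ?_⟩
    rcases haK.2 with rfl | ⟨C', hC', heC', haC'⟩
    · exact ⟨C, hC, haC, hbC⟩
    · exact hC'.exists_isCircuit_of_inter hC heC' hbC ⟨a, haC', haC⟩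

lemma intRk_restrict (M : Matroid α) (hAX : A ⊆ X) : (M ↾ X).intRk A = M.intRk A := by
  rw [intRk, M.restrict_eRk_eq hAX, intRk]

lemma isConnected_restrict_iff [M.Finite] (hZ : Z ⊆ M.E) :
    (M ↾ Z).IsConnected ↔ RankConn M.intRk ∅ Z := by
  have : (M ↾ Z).Finite := restrict_finite (M.ground_finite.subset hZ)
  rw [isConnected_iff_rankConn, restrict_ground_eq]
  simp only [RankConn]
  refine forall₃_congr fun A B _ ↦ forall_congr' fun hU ↦ ?_
  rw [intRk_restrict M (Set.empty_subset Z), intRk_restrict M subset_rfl,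
    intRk_restrict M (show A ⊆ Z from hU ▸ Set.subset_union_left),
    intRk_restrict M (show B ⊆ Z from hU ▸ Set.subset_union_right)]

lemma intRk_contract [M.Finite] (hZ : Z ⊆ M.E) (hA : A ⊆ M.E) (hdj : Disjoint Z A) :
    (M ／ Z).intRk A = M.intRk (A ∪ Z) - M.intRk Z := by
  obtain ⟨I, hI⟩ := M.exists_isBasis Z
  obtain ⟨K, hK, hIK⟩ := hI.indep.subset_isBasis_of_subset
    (hI.subset.trans (Set.subset_union_right (s := A))) (Set.union_subset hA hZ)
  have hKZ : K ∩ Z = I := (hI.eq_of_subset_indep (hK.indep.inter_right Z) (by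
    exact Set.subset_inter hIK hI.subset) Set.inter_subset_right).symm
  have hKI : K \ Z = K \ I := by grind
  have h1 := hK.contract_isBasis hI (by
    rw [hKI, Set.sdiff_union_of_subset hIK]; exact hK.indep)
  rw [Set.union_sdiff_right, hdj.symm.sdiff_eq_left, hKI] at h1
  rw [h1.intRk_eq, hK.intRk_eq, hI.intRk_eq]
  have := Set.ncard_sdiff_add_ncard_of_subset hIK hK.indep.finite
  omega

lemma isConnected_contract_iff [M.Finite] (hZ : Z ⊆ M.E) :
    (M ／ Z).IsConnected ↔ RankConn M.intRk Z M.E := by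
  have key : ∀ A ⊆ M.E \ Z, (M ／ Z).intRk A = M.intRk (A ∪ Z) - M.intRk Z := fun A hA ↦
    intRk_contract hZ (by grind) (Set.disjoint_left.2 fun x hx hxA ↦ (hA hxA).2 hx)
  rw [isConnected_iff_rankConn, contract_ground]
  refine ⟨fun h A B hAB hU hAZ hAE ↦ ?_, fun h A B hAB hU hAZ hAE ↦ ?_⟩
  · have hZA : Z ⊆ A := hAB ▸ Set.inter_subset_left
    have hZB : Z ⊆ B := hAB ▸ Set.inter_subset_right
    have hAE' : A ⊆ M.E := hU ▸ Set.subset_union_left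
    have hBE' : B ⊆ M.E := hU ▸ Set.subset_union_right
    have h1 := h (A \ Z) (B \ Z) (by grind) (by grind)
      (fun he ↦ hAZ (by rw [Set.sdiff_eq_empty] at he; exact he.antisymm hZA))
      (fun he ↦ hAE (by
        rw [← Set.sdiff_union_of_subset hZA, he, Set.sdiff_union_of_subset hZ]))
    rw [key _ (by grind), key _ (by grind), key _ (by grind), key _ (by grind),
      Set.sdiff_union_of_subset hZA, Set.sdiff_union_of_subset hZB, Set.sdiff_union_of_subset hZ,
      Set.empty_union] at h1
    linarith
  · have hAss : A ⊆ M.E \ Z := hU ▸ Set.subset_union_left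
    have hBss : B ⊆ M.E \ Z := hU ▸ Set.subset_union_right
    rw [key _ (by grind), key _ (by grind), key _ (by grind), key _ (by grind),
      Set.sdiff_union_of_subset hZ, Set.empty_union]
    have h1 := h (A ∪ Z) (B ∪ Z) (by rw [← Set.inter_union_distrib_right, hAB, Set.empty_union])
      (by rw [Set.union_union_union_comm, Set.union_self, hU, Set.sdiff_union_of_subset hZ])
      (fun he ↦ hAZ (by grind)) (fun he ↦ hAE (by grind))
    linarith

lemma isUniform_iff_rankUniform (M : Matroid α) [M.Finite] :
    M.IsUniform ↔ RankUniform M.intRk ∅ M.E := by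
  have hM := M.isRankFunction
  obtain ⟨B, hB⟩ := M.exists_isBase
  refine ⟨fun ⟨k, hk⟩ S _ hS ↦ ?_, fun h ↦ ⟨B.ncard, fun I hI ↦ ⟨fun hi ↦ ?_, fun hle ↦ ?_⟩⟩⟩
  · by_cases hSi : M.Indep S
    · exact Or.inl (by simp [hSi.intRk_eq, hM.empty])
    · right
      refine (hM.mono hS).antisymm ?_
      rw [hk S hS, not_le] at hSi
      obtain ⟨T, hTS, hT⟩ := Set.exists_subset_encard_eq hSi.le
      have hTi := (hk T (hTS.trans hS)).2 hT.le
      have h1 := hTi.ncard_le_intRk hTS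
      have h2 := (hk B hB.subset_ground).1 hB.indep
      rw [hB.intRk_ground]
      refine le_trans ?_ h1
      rw [Nat.cast_le, Set.ncard, Set.ncard]
      exact ENat.toNat_le_toNat (hT ▸ h2) (by simp [hT])
  · have := hi.ncard_le_intRk hI
    rw [hB.intRk_ground, Nat.cast_le] at this
    rw [← hi.finite.cast_ncard_eq]
    exact_mod_cast this
  · have hfin := M.ground_finite.subset hI
    rw [← hfin.cast_ncard_eq, Nat.cast_le] at hle
    refine indep_of_ncard_le_intRk hI ?_
    rcases h I (Set.empty_subset I) hI with h1 | h1
    · simp [h1, hM.empty]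
    · rw [h1, hB.intRk_ground]; exact_mod_cast hle

lemma isUniform_restrict_iff [M.Finite] (hZ : Z ⊆ M.E) :
    (M ↾ Z).IsUniform ↔ RankUniform M.intRk ∅ Z := by
  have : (M ↾ Z).Finite := restrict_finite (M.ground_finite.subset hZ)
  rw [isUniform_iff_rankUniform, restrict_ground_eq]
  simp only [RankUniform]
  refine forall₂_congr fun S _ ↦ forall_congr' fun hS ↦ ?_
  rw [intRk_restrict M (Set.empty_subset Z), intRk_restrict M subset_rfl, intRk_restrict M hS]

lemma isUniform_contract_iff [M.Finite] (hZ : Z ⊆ M.E) :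
    (M ／ Z).IsUniform ↔ RankUniform M.intRk Z M.E := by
  have key : ∀ A ⊆ M.E \ Z, (M ／ Z).intRk A = M.intRk (A ∪ Z) - M.intRk Z := fun A hA ↦
    intRk_contract hZ (by grind) (Set.disjoint_left.2 fun x hx hxA ↦ (hA hxA).2 hx)
  rw [isUniform_iff_rankUniform, contract_ground]
  refine ⟨fun h S hZS hS ↦ ?_, fun h S _ hS ↦ ?_⟩
  · have h1 := h (S \ Z) (Set.empty_subset _) (Set.sdiff_subset_sdiff_left hS)
    rw [key _ (by grind), key _ (by grind), key _ (by grind), Set.sdiff_union_of_subset hZS,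
      Set.sdiff_union_of_subset hZ, Set.empty_union, Set.sdiff_empty] at h1
    exact h1.imp (fun _ ↦ by linarith) (fun _ ↦ by linarith)
  · rw [key _ (by grind), key _ (by grind), key _ (by grind),
      Set.sdiff_union_of_subset hZ, Set.empty_union, Set.sdiff_empty]
    have h1 := h (S ∪ Z) Set.subset_union_right (by grind)
    rw [Set.union_sdiff_right, (Set.disjoint_left.2 fun x hx ↦ (hS hx).2).sdiff_eq_left] at h1
    exact h1.imp (fun _ ↦ by linarith) (fun _ ↦ by linarith)

lemma isSplitting_iff [M.Finite] :
    IsSplitting M.intRk M.E Z ↔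
      M.IsProperFlat Z ∧ M.IsCyclic Z ∧ (M ↾ Z).IsConnected ∧ (M ／ Z).IsConnected := by
  have hM := M.isRankFunction
  have hpos : ∀ A, 0 < M.eRk A ↔ 0 < M.intRk A := fun A ↦ by
    rw [← M.eRk_empty, eRk_lt_eRk_iff, hM.empty]
  constructor
  · intro h
    have hZ := h.subset
    refine ⟨⟨?_, (hpos Z).2 h.pos, ?_⟩, ?_, (isConnected_restrict_iff hZ).2 h.conn_restrict,
      (isConnected_contract_iff hZ).2 h.conn_contract⟩
    · rw [isFlat_iff_closure_eq]
      by_contra hne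
      have := hM.lt_of_ssubset h (M.subset_closure Z hZ) (M.closure_subset_ground Z) hne
      simp [intRk] at this
    · rw [← M.eRk_ground, eRk_lt_eRk_iff]; exact h.lt
    · refine ⟨{C | M.IsCircuit C ∧ C ⊆ Z}, fun C hC ↦ hC.1, ?_⟩
      refine Set.Subset.antisymm (fun e he ↦ ?_) (Set.sUnion_subset fun C hC ↦ hC.2)
      have h1 : 1 < Z.ncard := by have := h.lt_ncard; have := h.pos; omega
      obtain ⟨f, hf, hfe⟩ := Set.exists_ne_of_one_lt_ncard h1 e
      obtain ⟨C, hC, heC, -⟩ := (isConnected_restrict_iff hZ).2 h.conn_restrict e he f hf hfe.symm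
      exact ⟨C, (restrict_isCircuit_iff hZ).1 hC, heC⟩
  · rintro ⟨⟨hF, hZ0, hZ1⟩, ⟨S, hS, rfl⟩, hc, hc'⟩
    have hZ := hF.subset_ground
    refine ⟨hZ, (hpos _).1 hZ0, ?_, ?_, (isConnected_restrict_iff hZ).1 hc,
      (isConnected_contract_iff hZ).1 hc'⟩
    · rwa [← M.eRk_ground, eRk_lt_eRk_iff] at hZ1
    · by_contra! hle
      obtain ⟨C, hC⟩ : S.Nonempty := by
        by_contra! he
        simp [he] at hZ0
      exact (hS C hC).not_indep
        ((indep_of_ncard_le_intRk hZ hle).subset (Set.subset_sUnion_of_mem hC))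

/-- Extend `C \ {e}` to a base for a circuit `C` through `e` and `f`; then `C` is the fundamental
circuit of `e`. -/
lemma IsConnected.exists_isBase_exchange [M.Finite] (hM : M.IsConnected) (he : e ∈ M.E)
    (hf : f ∈ M.E) (hne : e ≠ f) :
    ∃ B, M.IsBase B ∧ f ∈ B ∧ e ∉ B ∧ M.IsBase (insert e (B \ {f})) := by
  obtain ⟨C, hC, heC, hfC⟩ := hM e he f hf hne
  obtain ⟨B, hB, hCB⟩ := (hC.sdiff_singleton_indep heC).exists_isBase_superset
  have heB : e ∉ B := fun heB ↦ hC.not_indep (hB.indep.subset (by grind))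
  have hfB : f ∈ B := hCB ⟨hfC, hne.symm⟩
  refine ⟨B, hB, hfB, heB, ?_⟩
  refine hB.exchange_isBase_of_indep heB (by_contra fun hI ↦ ?_)
  obtain ⟨C', hC'ss, hC'⟩ := ((M.not_indep_iff (by have := hB.subset_ground; grind)).1
    hI).exists_isCircuit_subset
  have h1 := hC.eq_fundCircuit_of_subset hB.indep (show C ⊆ insert e B by grind)
  have h2 := hC'.eq_fundCircuit_of_subset hB.indep (show C' ⊆ insert e B by grind)
  have := hC'ss ((h1.trans h2.symm) ▸ hfC)
  grind

/-- Bases of `M ↾ Z` and of `M ／ Z` combine to bases of `M`. -/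
lemma isBase_union_of_isBase_restrict_of_isBase_contract [M.Finite] (hZ : Z ⊆ M.E)
    (hI : (M ↾ Z).IsBase I) (hJ : (M ／ Z).IsBase J) : M.IsBase (I ∪ J) ∧ (I ∪ J) ∩ Z = I := by
  rw [isBase_restrict_iff] at hI
  obtain ⟨h1, hdj⟩ := hI.contract_indep_iff.1 hJ.indep
  rw [Set.union_comm] at h1
  refine ⟨h1.isBase_of_intRk_le ?_, ?_⟩
  · have h2 := hJ.intRk_ground
    rw [contract_ground, intRk_contract hZ (by grind) Set.disjoint_sdiff_right,
      Set.sdiff_union_of_subset hZ, hI.intRk_eq] at h2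
    rw [Set.ncard_union_eq (hdj.mono_left hI.subset) hI.indep.finite hJ.finite]
    push_cast
    linarith
  · rw [Set.union_inter_distrib_right, Set.inter_eq_left.2 hI.subset, hdj.symm.inter_eq,
      Set.union_empty]

end Matroid

/-! ### Polytopes, exposed faces and splits -/

section PolytopeSplits

lemma le_of_mem_convexHull {V : Type*} [AddCommGroup V] [Module ℝ V] {X : Set V} {f : V →ₗ[ℝ] ℝ}
    {c : ℝ} (h : ∀ x ∈ X, f x ≤ c) {x : V}
    (hx : x ∈ convexHull ℝ X) : f x ≤ c :=
  convexHull_min (t := {x | f x ≤ c}) h (convex_halfSpace_le f.isLinear c) hx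

variable {V : Type*} [AddCommGroup V] [Module ℝ V] [TopologicalSpace V]

/-- A valid inequality defines a face. -/
lemma isExposed_of_forall_le {P : Set V} (l : V →L[ℝ] ℝ) {c : ℝ} (h : ∀ x ∈ P, l x ≤ c) :
    IsExposed ℝ P {x ∈ P | l x = c} := by
  rintro ⟨y, hyP, hy⟩
  exact ⟨l, Set.ext fun x ↦ ⟨fun hx ↦ ⟨hx.1, fun z hz ↦ (h z hz).trans hx.2.ge⟩,
    fun hx ↦ ⟨hx.1, (h x hx.1).antisymm (hy ▸ hx.2 y hyP)⟩⟩⟩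

/-- A face of a face of a polytope is a face. -/
lemma IsExposed.trans_of_finite {X F G : Set V} (hX : X.Finite)
    (hF : IsExposed ℝ (convexHull ℝ X) F) (hG : IsExposed ℝ F G) :
    IsExposed ℝ (convexHull ℝ X) G := by
  rintro ⟨g, hg⟩
  have hgF := hG.subset hg
  obtain ⟨l, hl⟩ := hF ⟨g, hgF⟩
  obtain ⟨m, hm⟩ := hG ⟨g, hg⟩
  have hgP : g ∈ convexHull ℝ X := hF.subset hgF
  have hlmax : ∀ x ∈ convexHull ℝ X, l x ≤ l g := by
    have : g ∈ F := hgF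
    rw [hl] at this; exact this.2
  have hmmax : ∀ x ∈ F, m x ≤ m g := by
    have : g ∈ G := hg
    rw [hm] at this; exact this.2
  have hmemF : ∀ x ∈ convexHull ℝ X, l g ≤ l x → x ∈ F := fun x hx h ↦ by
    rw [hl]; exact ⟨hx, fun y hy ↦ (hlmax y hy).trans h⟩
  -- `K` is chosen so that `m + K • l` is maximal at `g` over the generators. Generators with `l p =
  -- l g` contribute the harmless quotient `0` by division by zero.
  obtain ⟨K, hK⟩ := (hX.image fun p ↦ (m p - m g) / (l g - l p)).bddAbove
  have hKX : ∀ p ∈ X, (m + K • l) p ≤ m g + K * l g := by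
    intro p hp
    have hpP := subset_convexHull ℝ X hp
    rcases (hlmax p hpP).lt_or_eq with h | h
    · have h1 : (m p - m g) / (l g - l p) ≤ K := hK ⟨p, hp, rfl⟩
      rw [div_le_iff₀ (by linarith)] at h1
      simp only [add_apply, smul_apply, smul_eq_mul]
      linarith
    · have := hmmax p (hmemF p hpP h.ge)
      simp only [add_apply, smul_apply, smul_eq_mul, h]
      linarith
  have hKP : ∀ x ∈ convexHull ℝ X, m x + K * l x ≤ m g + K * l g := fun x hx ↦
    le_of_mem_convexHull (f := (m + K • l : V →L[ℝ] ℝ).toLinearMap) hKX hx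
  -- The extra copy of `l` forces every maximizer into `F`.
  refine ⟨m + (K + 1) • l, Set.Subset.antisymm (fun x hx ↦ ?_) fun x ⟨hxP, hx⟩ ↦ ?_⟩
  · have hxF := hG.subset hx
    refine ⟨hF.subset hxF, fun y hy ↦ ?_⟩
    have h1 : l g ≤ l x := by rw [hl] at hxF; exact hxF.2 g hgP
    have h2 : m g ≤ m x := by rw [hm] at hx; exact hx.2 g hgF
    have h3 := hKP y hy
    have h4 := hlmax y hy
    have h5 := hlmax x (hF.subset hxF)
    have h6 : l x = l g := le_antisymm h5 h1
    simp only [add_apply, smul_apply, smul_eq_mul, h6]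
    linarith
  · have h1 := hx g hgP
    simp only [add_apply, smul_apply, smul_eq_mul] at h1
    have h2 := hKP x hxP
    have h3 := hlmax x hxP
    have hxF := hmemF x hxP (by linarith)
    have h4 : l x = l g := le_antisymm h3 (by linarith)
    rw [hm]
    refine ⟨hxF, fun y hy ↦ (hmmax y hy).trans ?_⟩
    rw [h4] at h1
    linarith

lemma IsPolytope.isExposed_trans {P F G : Set V} (hP : IsPolytope P) (hF : IsExposed ℝ P F)
    (hG : IsExposed ℝ F G) : IsExposed ℝ P G := by
  obtain ⟨X, hX, rfl⟩ := hP
  exact hF.trans_of_finite hX hG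

variable [IsTopologicalAddGroup V] [ContinuousSMul ℝ V] [T2Space V] [LocallyConvexSpace ℝ V]

lemma IsCompact.eq_convexHull_extremePoints {P : Set V} (hP : IsCompact P) (hc : Convex ℝ P)
    (hfin : (P.extremePoints ℝ).Finite) : P = convexHull ℝ (P.extremePoints ℝ) := by
  conv_lhs => rw [← closure_convexHull_extremePoints hP hc]
  exact (hfin.isClosed_convexHull ℝ).closure_eq

lemma IsPolytope.eq_convexHull_extremePoints {P : Set V} (hP : IsPolytope P) :
    P = convexHull ℝ (P.extremePoints ℝ) := by
  obtain ⟨X, hX, rfl⟩ := hP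
  exact (hX.isCompact_convexHull ℝ).eq_convexHull_extremePoints (convex_convexHull ℝ X)
    (hX.subset extremePoints_convexHull_subset)

lemma IsPolytope.isExposed {P F : Set V} (hP : IsPolytope P) (hF : IsExposed ℝ P F) :
    IsPolytope F := by
  obtain ⟨X, hX, rfl⟩ := hP
  have hfin : (F.extremePoints ℝ).Finite := hX.subset
    (hF.isExtreme.extremePoints_subset_extremePoints.trans extremePoints_convexHull_subset)
  exact ⟨_, hfin, (hF.isCompact (hX.isCompact_convexHull ℝ)).eq_convexHull_extremePoints
    (hF.convex (convex_convexHull ℝ X)) hfin⟩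

/-- Two polytopes without new vertices that cover `P` and meet in a common face induce a split. -/
lemma isPolytopeSplit_of_union {P Q₁ Q₂ : Set V} (h₁ : IsPolytope Q₁) (h₂ : IsPolytope Q₂)
    (hv₁ : Q₁.extremePoints ℝ ⊆ P.extremePoints ℝ) (hv₂ : Q₂.extremePoints ℝ ⊆ P.extremePoints ℝ)
    (hU : Q₁ ∪ Q₂ = P) (hI₁ : IsExposed ℝ Q₁ (Q₁ ∩ Q₂)) (hI₂ : IsExposed ℝ Q₂ (Q₁ ∩ Q₂))
    (h12 : ¬ Q₁ ⊆ Q₂) (h21 : ¬ Q₂ ⊆ Q₁) :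
    IsSplitHyperplane P (affineSpan ℝ (Q₁ ∩ Q₂)) := by
  set C : Set (Set V) := {F | IsExposed ℝ Q₁ F ∨ IsExposed ℝ Q₂ F} with hC
  have hle : ∀ F ∈ C, F ⊆ Q₁ ∨ F ⊆ Q₂ := fun F hF ↦ hF.imp (·.subset) (·.subset)
  have hm₁ : Maximal (· ∈ C) Q₁ := ⟨Or.inl (IsExposed.refl _), fun F hF hQF ↦
    (hle F hF).resolve_right fun h ↦ h12 (hQF.trans h)⟩
  have hm₂ : Maximal (· ∈ C) Q₂ := ⟨Or.inr (IsExposed.refl _), fun F hF hQF ↦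
    (hle F hF).resolve_left fun h ↦ h21 (hQF.trans h)⟩
  have hne : Q₁ ≠ Q₂ := fun h ↦ h12 h.le
  -- `F₂ ∩ (R₁ ∩ R₂)` is a face of the common face, hence of `R₁`, and meets `F₁` in `F₁ ∩ F₂`.
  have hcross : ∀ {R₁ R₂ F₁ F₂ : Set V}, IsPolytope R₁ → IsExposed ℝ R₁ (R₁ ∩ R₂) →
      IsExposed ℝ R₂ (R₁ ∩ R₂) → IsExposed ℝ R₁ F₁ → IsExposed ℝ R₂ F₂ →
      IsExposed ℝ F₁ (F₁ ∩ F₂) := by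
    intro R₁ R₂ F₁ F₂ hR hR₁ hR₂ hF₁ hF₂
    have h1 : IsExposed ℝ R₁ (F₂ ∩ (R₁ ∩ R₂)) := hR.isExposed_trans hR₁
      ((hF₂.inter hR₂).mono Set.inter_subset_right Set.inter_subset_right)
    have h2 := hF₁.inter h1
    have h3 : F₁ ∩ (F₂ ∩ (R₁ ∩ R₂)) = F₁ ∩ F₂ := by
      have := hF₁.subset
      have := hF₂.subset
      grind
    rw [h3] at h2
    exact h2.mono hF₁.subset Set.inter_subset_left
  have hinter : ∀ F₁ ∈ C, ∀ F₂ ∈ C, IsExposed ℝ F₁ (F₁ ∩ F₂) := by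
    have hI₁' : IsExposed ℝ Q₁ (Q₂ ∩ Q₁) := Set.inter_comm Q₁ Q₂ ▸ hI₁
    have hI₂' : IsExposed ℝ Q₂ (Q₂ ∩ Q₁) := Set.inter_comm Q₁ Q₂ ▸ hI₂
    rintro F₁ (hF₁ | hF₁) F₂ (hF₂ | hF₂)
    · exact (hF₁.inter hF₂).mono hF₁.subset Set.inter_subset_left
    · exact hcross h₁ hI₁ hI₂ hF₁ hF₂
    · exact hcross h₂ hI₂' hI₁' hF₁ hF₂
    · exact (hF₁.inter hF₂).mono hF₁.subset Set.inter_subset_left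
  refine ⟨C, Q₁, Q₂, ⟨?_, Or.inl isExposed_empty, ?_, ?_, ?_, ?_, ?_⟩, hm₁, hm₂, hne, rfl⟩
  · rintro F (hF | hF)
    exacts [h₁.isExposed hF, h₂.isExposed hF]
  · rintro F (hF | hF)
    exacts [hF.isExtreme.extremePoints_subset_extremePoints.trans hv₁,
      hF.isExtreme.extremePoints_subset_extremePoints.trans hv₂]
  · rintro F (hF | hF) G hG
    exacts [Or.inl (h₁.isExposed_trans hF hG), Or.inr (h₂.isExposed_trans hF hG)]
  · intro F₁ hF₁ F₂ hF₂ _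
    exact ⟨hinter F₁ hF₁ F₂ hF₂, Set.inter_comm F₂ F₁ ▸ hinter F₂ hF₂ F₁ hF₁⟩
  · rw [← hU]
    refine Set.Subset.antisymm (Set.sUnion_subset fun F hF ↦ ?_) (Set.union_subset ?_ ?_)
    · exact (hle F hF).elim (·.trans Set.subset_union_left) (·.trans Set.subset_union_right)
    · exact Set.subset_sUnion_of_mem hm₁.1
    · exact Set.subset_sUnion_of_mem hm₂.1
  · rw [show {Q | Maximal (· ∈ C) Q} = {Q₁, Q₂} from ?_, Set.encard_pair hne]
    ext F
    simp only [Set.mem_ofPred_eq, Set.mem_insert_iff, Set.mem_singleton_iff]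
    refine ⟨fun hF ↦ (hle F hF.1).imp (fun h ↦ ?_) (fun h ↦ ?_), ?_⟩
    · exact h.antisymm (hF.2 hm₁.1 h)
    · exact h.antisymm (hF.2 hm₂.1 h)
    · rintro (rfl | rfl)
      exacts [hm₁, hm₂]

/-- The hyperplane of a proper face of a polytope contains no split hyperplane. -/
lemma not_isSplitHyperplane_of_le {P : Set V} (hP : IsPolytope P) {f : V →L[ℝ] ℝ} {c : ℝ}
    (hf : ∀ x ∈ P, f x ≤ c) {p : V} (hp : p ∈ P) (hpc : f p < c) {S : AffineSubspace ℝ V}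
    (hS : ∀ x ∈ S, f x = c) : ¬ IsSplitHyperplane P S := by
  rintro ⟨C, Q₁, Q₂, hC, hm₁, hm₂, hne, rfl⟩
  -- Cells are determined by their vertices, which are among those of `P`. Finiteness puts every
  -- cell in a maximal one, so the two maximal cells cover `P`.
  have hfin : C.Finite := by
    obtain ⟨X, hX, rfl⟩ := hP
    have hPX := hX.subset (extremePoints_convexHull_subset (𝕜 := ℝ) (A := X))
    refine Set.Finite.of_finite_image (f := fun Q : Set V ↦ Q.extremePoints ℝ)
      (hPX.finite_subsets.subset ?_) ?_
    · rintro _ ⟨Q, hQ, rfl⟩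
      exact hC.vertices Q hQ
    · intro Q hQ Q' hQ' h
      rw [(hC.isPolytope Q hQ).eq_convexHull_extremePoints,
        (hC.isPolytope Q' hQ').eq_convexHull_extremePoints]
      exact congrArg _ h
  have hmax : {Q | Maximal (· ∈ C) Q} = {Q₁, Q₂} := by
    refine (Set.Finite.eq_of_subset_of_encard_le ?_ ?_ ?_).symm
    · exact Set.toFinite _
    · rintro Q (rfl | rfl)
      exacts [hm₁, hm₂]
    · rw [hC.two_maximal, Set.encard_pair hne]
  have hcov : P ⊆ Q₁ ∪ Q₂ := by
    intro x hx
    rw [← hC.sUnion_eq] at hx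
    obtain ⟨Q, hQ, hxQ⟩ := hx
    obtain ⟨R, hQR, hR⟩ := hfin.exists_le_maximal hQ
    have : R ∈ ({Q₁, Q₂} : Set (Set V)) := hmax ▸ hR
    rcases this with rfl | rfl
    exacts [Or.inl (hQR hxQ), Or.inr (hQR hxQ)]
  have hclosed : ∀ Q : Set V, IsPolytope Q → IsClosed Q := by
    rintro _ ⟨X, hX, rfl⟩
    exact hX.isClosed_convexHull ℝ
  have hc₁ := hclosed _ (hC.isPolytope _ hm₁.1)
  have hc₂ := hclosed _ (hC.isPolytope _ hm₂.1)
  have hPc : Convex ℝ P := by obtain ⟨X, -, rfl⟩ := hP; exact convex_convexHull ℝ X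
  -- `P'` is convex, hence connected, dense in `P`, and disjoint from `Q₁ ∩ Q₂`. The closed cells
  -- cannot both meet it, so one of them contains all of `P`.
  set P' : Set V := P ∩ {x | f x < c} with hP'
  have hP'c : Convex ℝ P' := hPc.inter (convex_halfSpace_lt f.toLinearMap.isLinear c)
  have hdense : P ⊆ closure P' := by
    intro x hx
    have h1 : x ∈ closure (openSegment ℝ x p) :=
      segment_subset_closure_openSegment (left_mem_segment ℝ x p)
    refine closure_mono ?_ h1
    rintro _ ⟨a, b, ha, hb, hab, rfl⟩
    refine ⟨hPc hx hp ha.le hb.le hab, ?_⟩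
    have h2 := hf x hx
    simp only [Set.mem_ofPred_eq, map_add, map_smul, smul_eq_mul]
    have : a * c + b * c = c := by rw [← add_mul, hab, one_mul]
    nlinarith
  have hdisj : ¬ (P' ∩ (Q₁ ∩ Q₂)).Nonempty := by
    rintro ⟨x, ⟨-, hxc⟩, hxQ⟩
    exact hxc.ne (hS x (subset_affineSpan ℝ _ hxQ))
  have hsub : ∀ Q, Maximal (· ∈ C) Q → Q ⊆ P := fun Q hQ ↦
    hC.sUnion_eq ▸ Set.subset_sUnion_of_mem hQ.1
  have hone : ∀ Q R, Maximal (· ∈ C) Q → Maximal (· ∈ C) R → IsClosed R → P ⊆ Q ∪ R →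
      ¬ (P' ∩ Q).Nonempty → Q = R := by
    intro Q R hQ hR hRc hQR hne
    have h1 : P' ⊆ R := fun x hx ↦ (hQR hx.1).resolve_left fun hxQ ↦ hne ⟨x, hx, hxQ⟩
    have h2 : Q ⊆ R := (hsub Q hQ).trans (hdense.trans (closure_minimal h1 hRc))
    exact h2.antisymm (hQ.2 hR.1 h2)
  by_cases hn₁ : (P' ∩ Q₁).Nonempty
  · by_cases hn₂ : (P' ∩ Q₂).Nonempty
    · exact hdisj (isPreconnected_closed_iff.1 hP'c.isPreconnected Q₁ Q₂ hc₁ hc₂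
        (Set.inter_subset_left.trans hcov) hn₁ hn₂)
    · exact hne (hone Q₂ Q₁ hm₂ hm₁ hc₁ (Set.union_comm Q₁ Q₂ ▸ hcov) hn₂).symm
  · exact hne (hone Q₁ Q₂ hm₁ hm₂ hc₂ hcov hn₁)

end PolytopeSplits

/-! ### Coordinate sums and slices of the cube -/

section Hypersimplex

open Filter Topology

variable {ι : Type*} {x : ι → ℝ}

lemma charVec_mem_Icc (B : Set ι) : charVec B ∈ Set.Icc (0 : ι → ℝ) 1 := by
  constructor <;> intro i <;> by_cases hi : i ∈ B <;> simp [charVec, hi]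

lemma eq_charVec_of_forall (h : ∀ i, x i = 0 ∨ x i = 1) : x = charVec {i | x i = 1} := by
  funext i
  rcases h i with hi | hi <;> simp [charVec, hi]

lemma charVec_mem_extremePoints (B : Set ι) {P : Set (ι → ℝ)} (hP : P ⊆ Set.Icc 0 1)
    (hB : charVec B ∈ P) : charVec B ∈ P.extremePoints ℝ := by
  refine ⟨hB, fun y hy z hz ⟨s, t, hs, ht, hst, h⟩ ↦ ?_⟩
  funext i
  have hyi := hP hy
  have hzi := hP hz
  have h0 := hyi.1 i
  have h1 := hyi.2 i
  have h2 := hzi.1 i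
  have h3 := hzi.2 i
  have hi := congrFun h i
  simp only [Pi.add_apply, Pi.smul_apply, smul_eq_mul, Pi.zero_apply, Pi.one_apply]
    at hi h0 h1 h2 h3
  by_cases hB : i ∈ B
  · have hc : (charVec B : ι → ℝ) i = 1 := by simp [charVec, hB]
    rw [hc] at hi ⊢
    nlinarith
  · have hc : (charVec B : ι → ℝ) i = 0 := by simp [charVec, hB]
    rw [hc] at hi ⊢
    nlinarith

variable [Finite ι] {S T : Set ι} {i j : ι} {r : ℕ} {a b : ℤ}

/-- The sum of the coordinates indexed by `S`, as a linear functional. -/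
noncomputable def coordSum (S : Set ι) : (ι → ℝ) →L[ℝ] ℝ :=
  ∑ i ∈ S.toFinite.toFinset, ContinuousLinearMap.proj i

lemma coordSum_apply (S : Set ι) (x : ι → ℝ) : coordSum S x = ∑ᶠ i ∈ S, x i := by
  simp [coordSum, finsum_mem_eq_finite_toFinset_sum _ S.toFinite]

lemma coordSum_union_add_inter (S T : Set ι) (x : ι → ℝ) :
    coordSum (S ∪ T) x + coordSum (S ∩ T) x = coordSum S x + coordSum T x := by
  simp only [coordSum_apply]
  exact finsum_mem_union_inter S.toFinite T.toFinite

@[simp] lemma coordSum_empty (x : ι → ℝ) : coordSum ∅ x = 0 := by simp [coordSum_apply]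

@[simp] lemma coordSum_singleton (i : ι) (x : ι → ℝ) : coordSum {i} x = x i := by
  simp [coordSum_apply]

lemma coordSum_add_compl (S : Set ι) (x : ι → ℝ) :
    coordSum S x + coordSum Sᶜ x = coordSum Set.univ x := by
  have := coordSum_union_add_inter S Sᶜ x
  simp only [Set.union_compl_self, Set.inter_compl_self, coordSum_empty, add_zero] at this
  exact this.symm

lemma coordSum_charVec (S B : Set ι) : coordSum S (charVec B) = (S ∩ B).ncard := by
  classical
  rw [coordSum_apply, finsum_mem_eq_finite_toFinset_sum _ S.toFinite,
    Set.ncard_eq_toFinset_card _ (S ∩ B).toFinite, Finset.cast_card]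
  simp only [charVec, Set.indicator_apply, Pi.one_apply]
  rw [← Finset.sum_filter]
  refine Finset.sum_congr ?_ fun _ _ ↦ rfl
  ext i; simp

/-- A fractional coordinate in an integral sum is accompanied by another one. -/
lemma exists_ne_fractional (hx : x ∈ Set.Icc (0 : ι → ℝ) 1) {m : ℤ} (hm : coordSum S x = m)
    (hi : i ∈ S) (h0 : 0 < x i) (h1 : x i < 1) : ∃ j ∈ S, j ≠ i ∧ 0 < x j ∧ x j < 1 := by
  by_contra! h
  have h2 : coordSum (S \ {i}) x = ((S \ {i}) ∩ {j | x j = 1}).ncard := by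
    rw [← coordSum_charVec, coordSum_apply, coordSum_apply]
    refine finsum_mem_congr rfl fun j hj ↦ ?_
    have h3 : 0 ≤ x j := hx.1 j
    have h4 : x j ≤ 1 := hx.2 j
    rcases h3.eq_or_lt with h5 | h5
    · simp [charVec, ← h5]
    · have h6 : x j = 1 := h4.antisymm (h j hj.1 hj.2 h5)
      simp [charVec, h6]
  have h3 := coordSum_union_add_inter (S \ {i}) {i} x
  rw [show S \ {i} ∪ {i} = S by grind, show S \ {i} ∩ {i} = ∅ by grind, coordSum_empty,
    coordSum_singleton, hm, h2, add_zero] at h3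
  have h4 : (0 : ℤ) < m - ((S \ {i}) ∩ {j | x j = 1}).ncard := by
    rw [← Int.cast_lt (R := ℝ)]; push_cast; linarith
  have h5 : m - ((S \ {i}) ∩ {j | x j = 1}).ncard < (1 : ℤ) := by
    rw [← Int.cast_lt (R := ℝ)]; push_cast; linarith
  omega

/-- The points of the cube with coordinate sum `r` and partial sum over `S` between `a` and `b`. -/
def slab (r : ℕ) (S : Set ι) (a b : ℤ) : Set (ι → ℝ) :=
  Set.Icc 0 1 ∩ (coordSum Set.univ ⁻¹' {(r : ℝ)} ∩ coordSum S ⁻¹' Set.Icc (a : ℝ) b)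

lemma convex_slab : Convex ℝ (slab r S a b) :=
  (convex_Icc 0 1).inter
    (((convex_singleton _).linear_preimage (coordSum Set.univ).toLinearMap).inter
    ((convex_Icc _ _).linear_preimage (coordSum S).toLinearMap))

lemma isCompact_slab : IsCompact (slab r S a b) :=
  isCompact_Icc.inter_right ((isClosed_singleton.preimage (coordSum Set.univ).continuous).inter
    (isClosed_Icc.preimage (coordSum S).continuous))

/-- A fractional coordinate `i` has a fractional partner `j`, and small moves along `±(e_i - e_j)`
stay in the slab. If the sum over `S` is an integer, `j` can be taken on the same side of `S`;
otherwise that sum is strictly between the integers `a` and `b`. -/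
lemma eq_zero_or_one_of_mem_extremePoints_slab (hx : x ∈ (slab r S a b).extremePoints ℝ) (i : ι) :
    x i = 0 ∨ x i = 1 := by
  classical
  obtain ⟨⟨hcube, hr, ha, hb⟩, hext⟩ := hx
  by_contra! hi
  have hi0 : 0 < x i := (hcube.1 i).lt_of_ne hi.1.symm
  have hi1 : x i < 1 := (hcube.2 i).lt_of_ne hi.2
  have hr' : coordSum Set.univ x = (r : ℤ) := by simpa using hr
  obtain ⟨j, hji, hj0, hj1, hS⟩ : ∃ j, j ≠ i ∧ 0 < x j ∧ x j < 1 ∧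
      ((i ∈ S ↔ j ∈ S) ∨ (a < coordSum S x ∧ coordSum S x < b)) := by
    by_cases hint : ∃ m : ℤ, coordSum S x = m
    · obtain ⟨m, hm⟩ := hint
      by_cases hiS : i ∈ S
      · obtain ⟨j, hjS, hji, hj0, hj1⟩ := exists_ne_fractional hcube hm hiS hi0 hi1
        exact ⟨j, hji, hj0, hj1, Or.inl ⟨fun _ ↦ hjS, fun _ ↦ hiS⟩⟩
      · have hm' : coordSum Sᶜ x = ((r - m : ℤ) : ℝ) := by
          have := coordSum_add_compl S x
          push_cast at hr' ⊢
          linarith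
        obtain ⟨j, hjS, hji, hj0, hj1⟩ := exists_ne_fractional hcube hm' (i := i) hiS hi0 hi1
        exact ⟨j, hji, hj0, hj1, Or.inl ⟨fun h ↦ (hiS h).elim, fun h ↦ (hjS h).elim⟩⟩
    · push Not at hint
      obtain ⟨j, -, hji, hj0, hj1⟩ := exists_ne_fractional hcube hr' (Set.mem_univ i) hi0 hi1
      exact ⟨j, hji, hj0, hj1, Or.inr ⟨ha.lt_of_ne (hint a).symm, hb.lt_of_ne (hint b)⟩⟩
  set v : ι → ℝ := Pi.single i 1 - Pi.single j 1 with hv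
  have hvsum : ∀ T : Set ι, (i ∈ T ↔ j ∈ T) → coordSum T v = 0 := by
    intro T hT
    have hs : ∀ k, (Pi.single k 1 : ι → ℝ) = charVec {k} := fun k ↦ by
      funext l
      simp [charVec, Set.indicator_apply, Pi.single_apply]
    rw [hv, map_sub, hs, hs, coordSum_charVec, coordSum_charVec]
    by_cases hiT : i ∈ T
    · rw [Set.inter_eq_right.2 (by simpa using hiT),
        Set.inter_eq_right.2 (by simpa using hT.1 hiT)]
      simp
    · have hjT : j ∉ T := fun h ↦ hiT (hT.2 h)
      rw [Set.inter_singleton_eq_empty.2 hiT, Set.inter_singleton_eq_empty.2 hjT]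
      simp
  have hcont : ∀ k, Tendsto (fun t : ℝ ↦ (x + t • v) k) (𝓝 0) (𝓝 (x k)) := by
    intro k
    have : Continuous fun t : ℝ ↦ (x + t • v) k := by
      simp only [Pi.add_apply, Pi.smul_apply, smul_eq_mul]; fun_prop
    simpa using this.tendsto 0
  have hcontS : Tendsto (fun t : ℝ ↦ coordSum S (x + t • v)) (𝓝 0) (𝓝 (coordSum S x)) := by
    have : Continuous fun t : ℝ ↦ coordSum S (x + t • v) := by fun_prop
    simpa using this.tendsto 0
  have hev : ∀ᶠ t in 𝓝 (0 : ℝ), x + t • v ∈ slab r S a b := by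
    have hk : ∀ k, ∀ᶠ t in 𝓝 (0 : ℝ), 0 ≤ (x + t • v) k ∧ (x + t • v) k ≤ 1 := by
      intro k
      by_cases hkij : k = i ∨ k = j
      · have h0 : 0 < x k := by rcases hkij with rfl | rfl <;> assumption
        have h1 : x k < 1 := by rcases hkij with rfl | rfl <;> assumption
        filter_upwards [(hcont k).eventually (lt_mem_nhds h0),
          (hcont k).eventually (gt_mem_nhds h1)] with t ht0 ht1
        exact ⟨ht0.le, ht1.le⟩
      · push Not at hkij
        refine Eventually.of_forall fun t ↦ ?_
        have : (x + t • v) k = x k := by simp [hv, hkij.1, hkij.2]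
        rw [this]
        exact ⟨hcube.1 k, hcube.2 k⟩
    have hSev : ∀ᶠ t in 𝓝 (0 : ℝ), coordSum S (x + t • v) ∈ Set.Icc (a : ℝ) b := by
      rcases hS with hS | ⟨hS1, hS2⟩
      · refine Eventually.of_forall fun t ↦ ?_
        rw [map_add, map_smul, hvsum S hS, smul_zero, add_zero]
        exact ⟨ha, hb⟩
      · filter_upwards [hcontS.eventually (lt_mem_nhds hS1),
          hcontS.eventually (gt_mem_nhds hS2)] with t ht0 ht1
        exact ⟨ht0.le, ht1.le⟩
    filter_upwards [eventually_all.2 hk, hSev] with t ht htS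
    refine ⟨⟨fun k ↦ (ht k).1, fun k ↦ (ht k).2⟩, ?_, htS⟩
    rw [Set.mem_preimage, map_add, map_smul, hvsum _ (by simp), smul_zero, add_zero]
    exact hr
  obtain ⟨ε, hε, hball⟩ := Metric.eventually_nhds_iff.1 hev
  have h1 := hball (y := ε / 2) (by rw [Real.dist_eq, sub_zero, abs_of_pos (by linarith)]; linarith)
  have h2 := hball (y := -(ε / 2))
    (by rw [Real.dist_eq, sub_zero, abs_neg, abs_of_pos (by linarith)]; linarith)
  have h3 := hext h1 h2 ⟨1 / 2, 1 / 2, by norm_num, by norm_num, by norm_num, by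
    funext k; simp; ring⟩
  have h4 := congrFun h3 i
  simp [hv, hji.symm] at h4
  linarith

lemma slab_eq_convexHull (r : ℕ) (S : Set ι) (a b : ℤ) :
    slab r S a b = convexHull ℝ (charVec '' {B : Set ι | B.encard = r ∧
      a ≤ (S ∩ B).ncard ∧ ((S ∩ B).ncard : ℤ) ≤ b}) := by
  have hsub : (slab r S a b).extremePoints ℝ ⊆ charVec '' {B : Set ι | B.encard = r ∧
      a ≤ (S ∩ B).ncard ∧ ((S ∩ B).ncard : ℤ) ≤ b} := by
    intro x hx
    have hx1 := eq_charVec_of_forall (eq_zero_or_one_of_mem_extremePoints_slab hx)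
    obtain ⟨⟨-, hr, hab⟩, -⟩ := hx
    refine ⟨_, ?_, hx1.symm⟩
    rw [hx1] at hr hab
    rw [Set.mem_preimage, coordSum_charVec] at hr hab
    rw [Set.mem_singleton_iff, Set.univ_inter, Nat.cast_inj] at hr
    refine ⟨?_, by exact_mod_cast hab.1, by exact_mod_cast hab.2⟩
    rw [← (Set.toFinite _).cast_ncard_eq, hr]
  refine Set.Subset.antisymm ?_ (convexHull_min ?_ convex_slab)
  · rw [isCompact_slab.eq_convexHull_extremePoints convex_slab ((Set.toFinite _).subset hsub)]
    exact convexHull_mono hsub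
  · rintro _ ⟨B, ⟨hr, ha, hb⟩, rfl⟩
    refine ⟨charVec_mem_Icc B, ?_, ?_⟩
    · rw [Set.mem_preimage, coordSum_charVec, Set.univ_inter, Set.ncard, hr]; simp
    · rw [Set.mem_preimage, coordSum_charVec]
      exact ⟨by exact_mod_cast ha, by exact_mod_cast hb⟩

lemma isPolytope_slab : IsPolytope (slab r S a b) :=
  ⟨_, Set.toFinite _, slab_eq_convexHull r S a b⟩

lemma hypersimplex_eq_slab (r : ℕ) (S : Set ι) : hypersimplex r ι = slab r S 0 S.ncard := by
  rw [slab_eq_convexHull, hypersimplex]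
  congr 2
  ext B
  have : (S ∩ B).ncard ≤ S.ncard := Set.ncard_le_ncard Set.inter_subset_left
  simpa using fun _ ↦ this

lemma mem_hypersimplex_iff :
    x ∈ hypersimplex r ι ↔ x ∈ Set.Icc (0 : ι → ℝ) 1 ∧ coordSum Set.univ x = r := by
  rw [hypersimplex_eq_slab r ∅]
  simp [slab]

lemma charVec_mem_hypersimplex {B : Set ι} (hB : B.ncard = r) : charVec B ∈ hypersimplex r ι := by
  rw [mem_hypersimplex_iff, coordSum_charVec, Set.univ_inter, hB]
  exact ⟨charVec_mem_Icc B, rfl⟩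

lemma coordSum_mem_Icc (hx : x ∈ Set.Icc (0 : ι → ℝ) 1) (S : Set ι) :
    0 ≤ coordSum S x ∧ coordSum S x ≤ S.ncard := by
  rw [coordSum_apply, finsum_mem_eq_finite_toFinset_sum _ S.toFinite,
    Set.ncard_eq_toFinset_card _ S.toFinite, Finset.cast_card]
  exact ⟨Finset.sum_nonneg fun i _ ↦ hx.1 i, Finset.sum_le_sum fun i _ ↦ hx.2 i⟩

lemma exists_ncard_eq_inter_ncard_eq {m n : ℕ} (hm : m ≤ S.ncard) (hn : n ≤ Sᶜ.ncard) :
    ∃ B : Set ι, B.ncard = m + n ∧ (S ∩ B).ncard = m := by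
  obtain ⟨A, hAS, hA⟩ := Set.exists_subset_card_eq hm
  obtain ⟨D, hDS, hD⟩ := Set.exists_subset_card_eq hn
  refine ⟨A ∪ D, ?_, ?_⟩
  · rw [Set.ncard_union_eq (Set.disjoint_left.2 fun i hi hi' ↦ hDS hi' (hAS hi)), hA, hD]
  · rw [← hA]; congr 1; grind

/-- A coordinate sum that takes values on both sides of `k` on the vertices of a hypersimplex
defines a split. -/
lemma isSplitHyperplane_hypersimplex {k : ℕ} (hk0 : 0 < k) (hkS : k < S.ncard) (hkr : k < r)
    (hrk : r - k < Sᶜ.ncard) :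
    IsSplitHyperplane (hypersimplex r ι)
      (affineSpan ℝ ({x | coordSum S x = k} ∩ hypersimplex r ι)) := by
  have hmem₁ : ∀ x, x ∈ slab r S 0 k ↔ x ∈ hypersimplex r ι ∧ coordSum S x ≤ k := by
    intro x
    rw [mem_hypersimplex_iff]
    simp only [slab, Set.mem_inter_iff, Set.mem_preimage, Set.mem_singleton_iff, Set.mem_Icc,
      Int.cast_zero, Int.cast_natCast]
    exact ⟨fun h ↦ ⟨⟨h.1, h.2.1⟩, h.2.2.2⟩,
      fun h ↦ ⟨h.1.1, h.1.2, (coordSum_mem_Icc h.1.1 S).1, h.2⟩⟩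
  have hmem₂ : ∀ x, x ∈ slab r S k S.ncard ↔ x ∈ hypersimplex r ι ∧ k ≤ coordSum S x := by
    intro x
    rw [mem_hypersimplex_iff]
    simp only [slab, Set.mem_inter_iff, Set.mem_preimage, Set.mem_singleton_iff, Set.mem_Icc,
      Int.cast_natCast]
    exact ⟨fun h ↦ ⟨⟨h.1, h.2.1⟩, h.2.2.1⟩,
      fun h ↦ ⟨h.1.1, h.1.2, h.2, (coordSum_mem_Icc h.1.1 S).2⟩⟩
  have hcube : hypersimplex r ι ⊆ Set.Icc 0 1 := fun x hx ↦ (mem_hypersimplex_iff.1 hx).1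
  have hvert : ∀ a b : ℤ, slab r S a b ⊆ hypersimplex r ι →
      (slab r S a b).extremePoints ℝ ⊆ (hypersimplex r ι).extremePoints ℝ := by
    intro a b hab x hx
    have h1 := hab hx.1
    rw [eq_charVec_of_forall (eq_zero_or_one_of_mem_extremePoints_slab hx)] at h1 ⊢
    exact charVec_mem_extremePoints _ hcube h1
  have hI : slab r S 0 k ∩ slab r S k S.ncard = {x | coordSum S x = k} ∩ hypersimplex r ι := by
    ext x
    simp only [Set.mem_inter_iff, hmem₁, hmem₂, Set.mem_ofPred_eq]
    exact ⟨fun h ↦ ⟨le_antisymm h.1.2 h.2.2, h.1.1⟩, fun h ↦ ⟨⟨h.2, h.1.le⟩, h.2, h.1.ge⟩⟩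
  -- Vertices with partial sums `k - 1` and `k + 1` show that neither cell contains the other.
  obtain ⟨B₁, hB₁, hB₁S⟩ := exists_ncard_eq_inter_ncard_eq (S := S) (m := k - 1) (n := r - k + 1)
    (by omega) (by omega)
  obtain ⟨B₂, hB₂, hB₂S⟩ := exists_ncard_eq_inter_ncard_eq (S := S) (m := k + 1) (n := r - k - 1)
    (by omega) (by omega)
  have hv₁ := charVec_mem_hypersimplex (r := r) (B := B₁) (by omega)
  have hv₂ := charVec_mem_hypersimplex (r := r) (B := B₂) (by omega)
  have hs₁ : coordSum S (charVec B₁) < k := by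
    rw [coordSum_charVec, hB₁S]; exact_mod_cast (by omega : k - 1 < k)
  have hs₂ : k < coordSum S (charVec B₂) := by
    rw [coordSum_charVec, hB₂S]; exact_mod_cast (by omega : k < k + 1)
  rw [← hI]
  refine isPolytopeSplit_of_union isPolytope_slab isPolytope_slab
    (hvert _ _ fun x hx ↦ ((hmem₁ x).1 hx).1) (hvert _ _ fun x hx ↦ ((hmem₂ x).1 hx).1) ?_ ?_ ?_
    (fun h ↦ ?_) (fun h ↦ ?_)
  · ext x
    simp only [Set.mem_union, hmem₁, hmem₂]
    rw [← and_or_left]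
    exact and_iff_left (le_total _ _)
  · have hQ : slab r S 0 k ∩ slab r S k S.ncard = {x ∈ slab r S 0 k | coordSum S x = k} := by
      ext x
      simp only [Set.mem_inter_iff, hmem₁, hmem₂, Set.mem_ofPred_eq]
      exact ⟨fun h ↦ ⟨h.1, h.1.2.antisymm h.2.2⟩, fun h ↦ ⟨h.1, h.1.1, h.2.ge⟩⟩
    rw [hQ]
    exact isExposed_of_forall_le _ fun x hx ↦ ((hmem₁ x).1 hx).2
  · have hQ : slab r S 0 k ∩ slab r S k S.ncard =
        {x ∈ slab r S k S.ncard | (-coordSum S) x = -(k : ℝ)} := by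
      ext x
      simp only [Set.mem_inter_iff, hmem₁, hmem₂, Set.mem_ofPred_eq, neg_apply, neg_inj]
      exact ⟨fun h ↦ ⟨h.2, h.1.2.antisymm h.2.2⟩, fun h ↦ ⟨⟨h.1.1, h.2.le⟩, h.1⟩⟩
    rw [hQ]
    exact isExposed_of_forall_le _ fun x hx ↦ neg_le_neg ((hmem₂ x).1 hx).2
  · exact hs₁.not_ge ((hmem₂ _).1 (h ((hmem₁ _).2 ⟨hv₁, hs₁.le⟩))).2
  · exact hs₂.not_ge ((hmem₁ _).1 (h ((hmem₂ _).2 ⟨hv₂, hs₂.le⟩))).2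

end Hypersimplex

/-! ### The matroid polytope -/

namespace Matroid

variable {α : Type*} {M : Matroid α} {A B F G I J X Y Z : Set α} {e f : α}

/-- The characteristic vector of `B` as a point of `ℝ^E`. -/
noncomputable def vec (M : Matroid α) (B : Set α) : M.E → ℝ := charVec ((↑) ⁻¹' B)

lemma ncard_preimage_coe (hF : F ⊆ M.E) : ((↑) ⁻¹' F : Set M.E).ncard = F.ncard :=
  Set.ncard_preimage_of_injective_subset_range Subtype.val_injective (by simpa using hF)

lemma IsBase.vec_mem_polytope (hB : M.IsBase B) : M.vec B ∈ M.polytope :=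
  subset_convexHull ℝ _ ⟨B, hB, rfl⟩

lemma polytope_subset_cube : M.polytope ⊆ Set.Icc 0 1 :=
  convexHull_min (by rintro _ ⟨B, -, rfl⟩; exact charVec_mem_Icc _) (convex_Icc 0 1)

section

variable [M.Finite]

instance finite_ground_coe : Finite M.E := M.ground_finite.to_subtype

/-- The sum of the coordinates indexed by `F`. -/
noncomputable def setSum (M : Matroid α) [M.Finite] (F : Set α) : (M.E → ℝ) →L[ℝ] ℝ :=
  coordSum ((↑) ⁻¹' F)

lemma mem_flatHyperplane {x : M.E → ℝ} : x ∈ M.flatHyperplane F ↔ M.setSum F x = M.intRk F := by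
  rw [flatHyperplane, setSum, coordSum_apply, intRk]
  simp

lemma setSum_union_add_inter (M : Matroid α) [M.Finite] (A B : Set α) (x : M.E → ℝ) :
    M.setSum (A ∪ B) x + M.setSum (A ∩ B) x = M.setSum A x + M.setSum B x :=
  coordSum_union_add_inter _ _ x

lemma setSum_empty (x : M.E → ℝ) : M.setSum ∅ x = 0 := by simp [setSum]

lemma setSum_union (hAB : A ∩ B = ∅) (x : M.E → ℝ) :
    M.setSum (A ∪ B) x = M.setSum A x + M.setSum B x := by
  rw [← setSum_union_add_inter, hAB, setSum_empty, add_zero]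

lemma setSum_ground (x : M.E → ℝ) : M.setSum M.E x = coordSum Set.univ x := by
  rw [setSum, Subtype.coe_preimage_self]

lemma setSum_vec (hB : B ⊆ M.E) : M.setSum F (M.vec B) = (F ∩ B).ncard := by
  rw [setSum, vec, coordSum_charVec, ← Set.preimage_inter,
    ncard_preimage_coe (Set.inter_subset_right.trans hB)]

lemma setSum_single [DecidableEq M.E] (i : M.E) :
    M.setSum F (Pi.single i 1) = F.indicator 1 (i : α) := by
  have h : (Pi.single i 1 : M.E → ℝ) = charVec {i} := by
    funext j
    simp [charVec, Set.indicator_apply, Pi.single_apply]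
  rw [setSum, h, coordSum_charVec]
  by_cases hi : (i : α) ∈ F
  · rw [Set.inter_eq_right.2 (by simpa using hi)]
    simp [hi]
  · rw [Set.inter_singleton_eq_empty.2 (by simpa using hi)]
    simp [hi]

lemma setSum_coe (x : α → ℝ) (hF : F ⊆ M.E) :
    M.setSum F (fun i ↦ x i) = ∑ᶠ e ∈ F, x e := by
  rw [setSum, coordSum_apply, ← finsum_mem_image (f := x) Subtype.val_injective.injOn,
    Subtype.image_preimage_coe, Set.inter_eq_right.2 hF]

lemma setSum_le {x : M.E → ℝ} (hx : x ∈ M.polytope) (F : Set α) : M.setSum F x ≤ M.intRk F := by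
  refine le_of_mem_convexHull (f := (M.setSum F).toLinearMap) ?_ hx
  rintro _ ⟨B, hB, rfl⟩
  change M.setSum F (M.vec B) ≤ _
  rw [setSum_vec hB.subset_ground]
  exact_mod_cast (hB.indep.inter_left F).ncard_le_intRk Set.inter_subset_left

lemma IsBase.setSum_ground_vec (hB : M.IsBase B) : M.setSum M.E (M.vec B) = M.intRk M.E := by
  rw [setSum_vec hB.subset_ground, Set.inter_eq_right.2 hB.subset_ground, hB.intRk_ground]
  simp

lemma setSum_ground_eq {x : M.E → ℝ} (hx : x ∈ M.polytope) : M.setSum M.E x = M.intRk M.E := by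
  refine (setSum_le hx M.E).antisymm ?_
  have h := le_of_mem_convexHull (f := (-M.setSum M.E).toLinearMap) (c := -(M.intRk M.E : ℝ)) ?_ hx
  · exact neg_le_neg_iff.1 h
  · rintro _ ⟨B, hB, rfl⟩
    exact neg_le_neg hB.setSum_ground_vec.ge

lemma exists_isBase_of_subset (hAB : A ⊆ B) (hB : B ⊆ M.E) :
    ∃ B₀, M.IsBase B₀ ∧ M.setSum A (M.vec B₀) = M.intRk A ∧ M.setSum B (M.vec B₀) = M.intRk B := by
  obtain ⟨I, hI⟩ := M.exists_isBasis A (hAB.trans hB)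
  obtain ⟨J, hJ, hIJ⟩ := hI.exists_isBasis_inter_eq_of_superset hAB hB
  obtain ⟨K, hK, hJK⟩ := hJ.exists_isBasis_inter_eq_of_superset hB
  have hK' := isBasis_ground_iff.1 hK
  refine ⟨K, hK', ?_, ?_⟩
  · rw [setSum_vec hK'.subset_ground, hI.intRk_eq, ← hIJ, ← hJK, Set.inter_assoc,
      Set.inter_eq_right.2 hAB, Set.inter_comm]
    simp
  · rw [setSum_vec hK'.subset_ground, hJ.intRk_eq, ← hJK, Set.inter_comm]
    simp

lemma setSum_add_diff (hAB : A ⊆ B) (x : M.E → ℝ) :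
    M.setSum A x + M.setSum (B \ A) x = M.setSum B x := by
  rw [← setSum_union (by grind), Set.union_sdiff_cancel hAB]

lemma sep_lt (hE : RankConn M.intRk ∅ M.E) (hA : A ⊆ M.E) (hne : A.Nonempty) (hAE : A ≠ M.E) :
    M.intRk M.E < M.intRk A + M.intRk (M.E \ A) := by
  have := hE A (M.E \ A) (by grind) (by grind) hne.ne_empty hAE
  rwa [M.isRankFunction.empty, zero_add] at this

/-- A base tight on `E \ A` cannot be tight on `A`, as the two ranks exceed the total; it can be
chosen tight on `B` as well. -/
lemma exists_isBase_setSum_lt (hE : RankConn M.intRk ∅ M.E) (hA : A ⊆ M.E) (hne : A.Nonempty)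
    (hAE : A ≠ M.E) (hBA : B ⊆ M.E \ A) :
    ∃ B₀, M.IsBase B₀ ∧ M.setSum B (M.vec B₀) = M.intRk B ∧ M.setSum A (M.vec B₀) < M.intRk A := by
  obtain ⟨B₀, hB₀, h1, h2⟩ := exists_isBase_of_subset hBA (Set.sdiff_subset (s := M.E) (t := A))
  refine ⟨B₀, hB₀, h1, ?_⟩
  have h3 := setSum_add_diff hA (M.vec B₀)
  rw [h2, hB₀.setSum_ground_vec] at h3
  have h4 : (M.intRk M.E : ℝ) < M.intRk A + M.intRk (M.E \ A) := by
    exact_mod_cast sep_lt hE hA hne hAE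
  linarith

/-- The face of the matroid polytope cut out by `H(F)`. -/
lemma mem_face {x : M.E → ℝ} :
    x ∈ M.flatHyperplane F ∩ M.polytope ↔ x ∈ M.polytope ∧ M.setSum F x = M.intRk F := by
  rw [Set.mem_inter_iff, mem_flatHyperplane, and_comm]

lemma isExposed_face (F : Set α) : IsExposed ℝ M.polytope (M.flatHyperplane F ∩ M.polytope) := by
  have h : M.flatHyperplane F ∩ M.polytope = {x ∈ M.polytope | M.setSum F x = M.intRk F} :=
    Set.ext fun x ↦ mem_face
  rw [h]
  exact isExposed_of_forall_le _ fun x hx ↦ setSum_le hx F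

lemma face_ne_polytope (hE : RankConn M.intRk ∅ M.E) (hA : A ⊆ M.E) (hne : A.Nonempty)
    (hAE : A ≠ M.E) : M.flatHyperplane A ∩ M.polytope ≠ M.polytope := by
  intro h
  obtain ⟨B, hB, -, hlt⟩ := exists_isBase_setSum_lt hE hA hne hAE (Set.empty_subset _)
  have := hB.vec_mem_polytope
  rw [← h, mem_face] at this
  exact hlt.ne this.2

lemma face_eq_polytope (h : ∀ x ∈ M.polytope, M.setSum F x = M.intRk F) :
    M.flatHyperplane F ∩ M.polytope = M.polytope :=
  Set.ext fun x ↦ by rw [mem_face]; exact and_iff_left_of_imp (h x)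

lemma face_eq_of_isFacet (hE : RankConn M.intRk ∅ M.E)
    (hF : IsFacet M.polytope (M.flatHyperplane F ∩ M.polytope)) (hA : A ⊆ M.E) (hne : A.Nonempty)
    (hAE : A ≠ M.E) (h : ∀ x ∈ M.polytope, M.setSum F x = M.intRk F → M.setSum A x = M.intRk A)
    {x : M.E → ℝ} (hx : x ∈ M.polytope) (hxA : M.setSum A x = M.intRk A) :
    M.setSum F x = M.intRk F := by
  have hsub : M.flatHyperplane F ∩ M.polytope ⊆ M.flatHyperplane A ∩ M.polytope := fun x hx ↦ by
    rw [mem_face] at hx ⊢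
    exact ⟨hx.1, h x hx.1 hx.2⟩
  have heq : M.flatHyperplane F ∩ M.polytope = M.flatHyperplane A ∩ M.polytope := by
    by_contra hne'
    exact face_ne_polytope hE hA hne hAE (hF.2.2 _ (isExposed_face A) (hsub.ssubset_of_ne hne'))
  have : x ∈ M.flatHyperplane A ∩ M.polytope := mem_face.2 ⟨hx, hxA⟩
  rw [← heq, mem_face] at this
  exact this.2

/-- For a separation `F = A ∪ B`, tightness on `F` forces tightness on both parts, so the facet is
also the face of `B`. A base tight on `B` but not on `A` is then tight on `F`, which is impossible.
-/
lemma rankConn_restrict_of_isFacet (hE : RankConn M.intRk ∅ M.E) (hFE : F ⊆ M.E)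
    (hF : IsFacet M.polytope (M.flatHyperplane F ∩ M.polytope)) : RankConn M.intRk ∅ F := by
  intro A B hAB hU hA hAF
  by_contra! hle
  rw [M.isRankFunction.empty, zero_add] at hle
  have hle' : (M.intRk A : ℝ) + M.intRk B ≤ M.intRk F := by exact_mod_cast hle
  have hsum : ∀ x, M.setSum F x = M.setSum A x + M.setSum B x := fun x ↦ by
    rw [← hU, setSum_union hAB]
  have hAE : A ⊆ M.E := by grind
  have hAne : A.Nonempty := Set.nonempty_iff_ne_empty.2 hA
  have hAne' : A ≠ M.E := fun h ↦ hAF (by grind)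
  have hBne : B.Nonempty := Set.nonempty_iff_ne_empty.2 (by
      rintro rfl; exact hAF (by simpa using hU))
  have hBne' : B ≠ M.E := by
    obtain ⟨a, ha⟩ := hAne
    rintro rfl
    have : a ∈ A ∩ M.E := ⟨ha, hAE ha⟩
    simp [hAB] at this
  obtain ⟨B₀, hB₀, h1, h2⟩ := exists_isBase_setSum_lt hE hAE hAne hAne' (B := B)
    (fun b hb ↦ ⟨hFE (hU ▸ Or.inr hb), fun hbA ↦ by
      have : b ∈ A ∩ B := ⟨hbA, hb⟩
      simp [hAB] at this⟩)
  have h3 := face_eq_of_isFacet hE hF (A := B) (by grind) hBne hBne' (fun x hx hxF ↦ by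
    have h4 := setSum_le hx A
    have h5 := setSum_le hx B
    rw [hsum] at hxF
    linarith) hB₀.vec_mem_polytope h1
  rw [hsum] at h3
  linarith

/-- A separation of `E` along `F` makes the facet equal to the faces of `A` and of `B`. Bases tight
on `A \ F ⊆ A` are thus tight on `F`, so `r(A) ≥ r(F) + r(A \ F)`; likewise for `B`. Adding up, `F`
and `E \ F` separate the connected `M`. -/
lemma rankConn_contract_of_isFacet (hE : RankConn M.intRk ∅ M.E) (hFE : F ⊆ M.E)
    (hF : IsFacet M.polytope (M.flatHyperplane F ∩ M.polytope)) : RankConn M.intRk F M.E := by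
  have hFne : F.Nonempty := by
    by_contra! he
    exact hF.2.1 (face_eq_polytope fun x hx ↦ by simp [he, setSum_empty, M.isRankFunction.empty])
  have hFne' : F ≠ M.E := by
    rintro rfl
    exact hF.2.1 (face_eq_polytope fun x hx ↦ setSum_ground_eq hx)
  have key : ∀ A B, A ∩ B = F → A ∪ B = M.E → A ≠ M.E →
      M.intRk A + M.intRk B ≤ M.intRk F + M.intRk M.E →
      M.intRk F + M.intRk (A \ F) ≤ M.intRk A := by
    intro A B hAB hU hA hle
    have hle' : (M.intRk A : ℝ) + M.intRk B ≤ M.intRk F + M.intRk M.E := by exact_mod_cast hle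
    have hFA : F ⊆ A := hAB ▸ Set.inter_subset_left
    have hAE : A ⊆ M.E := hU ▸ Set.subset_union_left
    obtain ⟨B₀, hB₀, h1, h2⟩ := exists_isBase_of_subset (Set.sdiff_subset (s := A) (t := F)) hAE
    have h3 := face_eq_of_isFacet hE hF hAE (hFne.mono hFA) hA (fun x hx hxF ↦ by
      have h4 := setSum_le hx A
      have h5 := setSum_le hx B
      have h6 := setSum_union_add_inter M A B x
      rw [hU, hAB, setSum_ground_eq hx, hxF] at h6
      linarith) hB₀.vec_mem_polytope h2
    have h4 := setSum_add_diff hFA (M.vec B₀)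
    rw [h1, h2, h3] at h4
    exact_mod_cast h4.le
  intro A B hAB hU hAF hAE
  by_contra! hle
  have h1 := key A B hAB hU hAE (by linarith)
  have h2 := key B A (by rwa [Set.inter_comm]) (by rwa [Set.union_comm])
    (fun h ↦ hAF (by rw [← hAB, h]; exact (Set.inter_eq_left.2 (hU ▸ Set.subset_union_left)).symm))
    (by linarith)
  have h3 := sep_lt hE hFE hFne hFne'
  have h4 := M.isRankFunction.submod (A \ F) (B \ F)
  have h5 := M.isRankFunction.nonneg (A \ F ∩ (B \ F))
  rw [← Set.union_sdiff_distrib, hU] at h4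
  linarith

end

end Matroid

namespace Matroid

variable {α : Type*} {M : Matroid α} {A B F G I J X Y Z : Set α} {e f : α}

/-! ### Linear functionals on faces -/

lemma vec_exchange [DecidableEq M.E] {i j : M.E} (hj : (j : α) ∈ B) (hi : (i : α) ∉ B) :
    M.vec (insert (i : α) (B \ {(j : α)})) + Pi.single j 1 = M.vec B + Pi.single i 1 := by
  classical
  funext k
  have hij : i ≠ j := by rintro rfl; exact hi hj
  simp only [vec, charVec, Pi.add_apply, Set.indicator_apply, Pi.one_apply, Set.mem_preimage,
    Set.mem_insert_iff, Set.mem_sdiff, Set.mem_singleton_iff, Pi.single_apply, Subtype.coe_inj]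
  by_cases hki : k = i
  · subst hki; simp [hi, hij]
  · by_cases hkj : k = j
    · subst hkj; simp [hj, hki]
    · simp [hki, hkj]

variable [M.Finite]

lemma IsConnected.single_sub_single_mem [DecidableEq M.E] (hM : M.IsConnected) (i j : M.E) :
    (Pi.single i 1 - Pi.single j 1 : M.E → ℝ) ∈ vectorSpan ℝ M.polytope := by
  by_cases hij : i = j
  · simp [hij]
  obtain ⟨B, hB, hjB, hiB, hB'⟩ := hM.exists_isBase_exchange i.2 j.2 (by simpa [Subtype.coe_inj])
  have h1 := vsub_mem_vectorSpan ℝ hB'.vec_mem_polytope hB.vec_mem_polytope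
  rwa [vsub_eq_sub, sub_eq_sub_iff_add_eq_add.2 (by
    rw [vec_exchange hjB hiB, add_comm] : M.vec (insert (i : α) (B \ {(j : α)})) + Pi.single j 1 =
      Pi.single i 1 + M.vec B)] at h1

/-- Exchanging `j` for `i` in a base of `M|Z` or of `M/Z`, with a fixed base of the other minor,
gives two tight bases of `M` differing by `e_i - e_j`. -/
lemma single_eq_single_of_face [DecidableEq M.E] (hZ : Z ⊆ M.E) (hc : (M ↾ Z).IsConnected)
    (hc' : (M ／ Z).IsConnected) {l : (M.E → ℝ) →L[ℝ] ℝ} {c : ℝ}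
    (hl : ∀ B, M.IsBase B → M.setSum Z (M.vec B) = M.intRk Z → l (M.vec B) = c) {i j : M.E}
    (hij : (i : α) ∈ Z ↔ (j : α) ∈ Z) : l (Pi.single i 1) = l (Pi.single j 1) := by
  have : (M ↾ Z).Finite := restrict_finite (M.ground_finite.subset hZ)
  by_cases hne : i = j
  · rw [hne]
  have hne' : (i : α) ≠ j := by simpa [Subtype.coe_inj]
  have tight : ∀ {I J}, (M ↾ Z).IsBase I → (M ／ Z).IsBase J →
      M.IsBase (I ∪ J) ∧ l (M.vec (I ∪ J)) = c := by
    intro I J hI hJ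
    obtain ⟨h1, h2⟩ := isBase_union_of_isBase_restrict_of_isBase_contract hZ hI hJ
    refine ⟨h1, hl _ h1 ?_⟩
    rw [setSum_vec h1.subset_ground, Set.inter_comm, h2, ((isBase_restrict_iff hZ).1 hI).intRk_eq]
    simp
  suffices h : ∃ B, (j : α) ∈ B ∧ (i : α) ∉ B ∧ l (M.vec B) = c ∧
      l (M.vec (insert (i : α) (B \ {(j : α)}))) = c by
    obtain ⟨B, hj, hi, h1, h2⟩ := h
    have h3 := congrArg l (vec_exchange (M := M) hj hi)
    rw [map_add, map_add, h1, h2] at h3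
    linarith
  obtain ⟨I₀, hI₀⟩ := (M ↾ Z).exists_isBase
  obtain ⟨J₀, hJ₀⟩ := (M ／ Z).exists_isBase
  by_cases hi : (i : α) ∈ Z
  · have hj := hij.1 hi
    obtain ⟨B, hB, hjB, hiB, hB'⟩ := hc.exists_isBase_exchange hi hj hne'
    have hJZ : ∀ x ∈ J₀, x ∉ Z := fun x hx ↦ (hJ₀.subset_ground hx).2
    refine ⟨B ∪ J₀, Or.inl hjB, fun h ↦ h.elim hiB fun h ↦ hJZ _ h hi, (tight hB hJ₀).2, ?_⟩
    rw [← (tight hB' hJ₀).2]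
    congr 2
    have := hJZ j
    grind
  · have hj := fun h ↦ hi (hij.2 h)
    obtain ⟨B, hB, hjB, hiB, hB'⟩ := hc'.exists_isBase_exchange (e := (i : α)) (f := (j : α))
      ⟨i.2, hi⟩ ⟨j.2, hj⟩ hne'
    have hIZ : I₀ ⊆ Z := hI₀.subset_ground
    refine ⟨I₀ ∪ B, Or.inr hjB, fun h ↦ h.elim (fun h ↦ hi (hIZ h)) hiB, (tight hI₀ hB).2, ?_⟩
    rw [← (tight hI₀ hB').2]
    congr 2
    grind

/-- A functional that is constant on the face of a splitting set is a combination of the two block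
sums. -/
lemma exists_eq_of_face (hZ : IsSplitting M.intRk M.E Z) {l : (M.E → ℝ) →L[ℝ] ℝ} {c : ℝ}
    (hl : ∀ B, M.IsBase B → M.setSum Z (M.vec B) = M.intRk Z → l (M.vec B) = c) :
    ∃ a b : ℝ, ∀ x, l x = a * M.setSum Z x + b * M.setSum (M.E \ Z) x := by
  classical
  have hss := hZ.subset
  have key := fun {i j : M.E} ↦ single_eq_single_of_face hss
    ((isConnected_restrict_iff hss).2 hZ.conn_restrict)
    ((isConnected_contract_iff hss).2 hZ.conn_contract) hl (i := i) (j := j)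
  have hblock : ∀ p : M.E → Prop, (∀ i j, p i → p j → ((i : α) ∈ Z ↔ (j : α) ∈ Z)) →
      ∃ a, ∀ i, p i → l (Pi.single i 1) = a := by
    intro p hp
    by_cases h : ∃ i, p i
    · obtain ⟨i, hi⟩ := h
      exact ⟨l (Pi.single i 1), fun j hj ↦ key (hp j i hj hi)⟩
    · exact ⟨0, fun i hi ↦ (h ⟨i, hi⟩).elim⟩
  obtain ⟨a, ha⟩ := hblock (fun i ↦ (i : α) ∈ Z) (by simp +contextual)
  obtain ⟨b, hb⟩ := hblock (fun i ↦ (i : α) ∉ Z) (by simp +contextual)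
  refine ⟨a, b, fun x ↦ ?_⟩
  have h : l.toLinearMap = (a • M.setSum Z + b • M.setSum (M.E \ Z)).toLinearMap := by
    refine LinearMap.pi_ext' fun i ↦ LinearMap.ext_ring ?_
    simp only [LinearMap.comp_apply, LinearMap.single_apply, ContinuousLinearMap.coe_coe,
      add_apply, smul_apply, smul_eq_mul, setSum_single, Set.indicator_apply]
    by_cases hi : (i : α) ∈ Z
    · simp [hi, ha i hi]
    · simp [hi, hb i hi, i.2]
  exact congrArg (fun g : (M.E → ℝ) →ₗ[ℝ] ℝ ↦ g x) h

/-! ### Splitting sets are the split flacets -/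

lemma nonempty_of_isSplitting (hZ : IsSplitting M.intRk M.E Z) : Z.Nonempty := by
  by_contra! he
  have := hZ.pos
  rw [he, M.isRankFunction.empty] at this
  exact this.false

/-- A functional exposing a larger face is, on the polytope, an affine function of the sum over `Z`.
It takes the same value at a point off the facet, so it is constant. -/
lemma isFacet_of_isSplitting (hE : RankConn M.intRk ∅ M.E) (hZ : IsSplitting M.intRk M.E Z) :
    IsFacet M.polytope (M.flatHyperplane Z ∩ M.polytope) := by
  refine ⟨isExposed_face Z, face_ne_polytope hE hZ.subset (nonempty_of_isSplitting hZ)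
    hZ.ne_ground, fun G hG hss ↦ ?_⟩
  obtain ⟨x, hxG, hx⟩ := Set.exists_of_ssubset hss
  obtain ⟨l, hl⟩ := hG ⟨x, hxG⟩
  have hxG' := hxG
  rw [hl] at hxG'
  obtain ⟨hxP, hmax⟩ := hxG'
  have hconst : ∀ y ∈ G, l y = l x := fun y hy ↦ by
    rw [hl] at hy
    exact (hmax y hy.1).antisymm (hy.2 x hxP)
  obtain ⟨a, b, hab⟩ := exists_eq_of_face hZ (l := l) (c := l x) fun B hB hBZ ↦
    hconst _ (hss.1 (mem_face.2 ⟨hB.vec_mem_polytope, hBZ⟩))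
  have hP : ∀ y ∈ M.polytope, l y = (a - b) * M.setSum Z y + b * M.intRk M.E := fun y hy ↦ by
    rw [hab, ← setSum_ground_eq hy, ← setSum_add_diff hZ.subset y]
    ring
  obtain ⟨B, hB, hBZ, -⟩ := exists_isBase_of_subset (M := M) subset_rfl hZ.subset
  have hBG := hconst _ (hss.1 (mem_face.2 ⟨hB.vec_mem_polytope, hBZ⟩))
  rw [hP _ hB.vec_mem_polytope, hP x hxP, hBZ] at hBG
  have hne : M.setSum Z x ≠ M.intRk Z := fun h ↦ hx (mem_face.2 ⟨hxP, h⟩)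
  have h1 : (a - b) * (M.intRk Z - M.setSum Z x) = 0 := by linarith
  have h2 : a - b = 0 := (mul_eq_zero.1 h1).resolve_right (sub_ne_zero.2 hne.symm)
  refine hG.subset.antisymm fun y hy ↦ ?_
  rw [hl]
  refine ⟨hy, fun z hz ↦ ?_⟩
  rw [hP y hy, hP z hz, h2]
  simp

lemma isFlacet_of_isSplitting (hE : RankConn M.intRk ∅ M.E) (hZ : IsSplitting M.intRk M.E Z) :
    M.IsFlacet Z := by
  classical
  have hfac := isFacet_of_isSplitting hE hZ
  refine ⟨⟨⟨(isSplitting_iff.1 hZ).1.1, rfl⟩, fun G ⟨hG, hGZ⟩ hsub ↦ ?_⟩, hfac⟩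
  -- The indicator of `G` is constant on `Z`; since `G ⊆ Z` is nonempty, it equals `Z`.
  obtain ⟨a, b, hab⟩ := exists_eq_of_face hZ (l := M.setSum G) (c := M.intRk G) fun B hB hBZ ↦ by
    have : M.vec B ∈ M.flatHyperplane Z ∩ M.polytope := mem_face.2 ⟨hB.vec_mem_polytope, hBZ⟩
    rw [← hGZ] at this
    exact (mem_face.1 this).2
  have hGne : G.Nonempty := by
    by_contra! he
    exact hfac.2.1 (hGZ ▸ face_eq_polytope fun x hx ↦ by
      simp [he, setSum_empty, M.isRankFunction.empty])
  obtain ⟨g, hg⟩ := hGne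
  have hval : ∀ z (hz : z ∈ Z), G.indicator 1 z = a := fun z hz ↦ by
    have h1 := hab (Pi.single ⟨z, hZ.subset hz⟩ 1)
    rw [setSum_single, setSum_single, setSum_single] at h1
    simpa [hz] using h1
  intro z hz
  by_contra hzG
  have h1 := hval z hz
  have h2 := hval g (hsub hg)
  rw [← h1] at h2
  simp [hg, hzG] at h2

lemma flatHyperplane_eq (M : Matroid α) [M.Finite] (F : Set α) :
    M.flatHyperplane F = {x | coordSum ((↑) ⁻¹' F : Set M.E) x = ((M.eRk F).toNat : ℝ)} := by
  ext x
  rw [mem_flatHyperplane]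
  rfl

lemma eRank_toNat (M : Matroid α) : (M.eRank.toNat : ℤ) = M.intRk M.E := by
  rw [intRk, eRk_ground]

lemma isSplitFlacet_of_isSplitting (hE : RankConn M.intRk ∅ M.E)
    (hZ : IsSplitting M.intRk M.E Z) : M.IsSplitFlacet Z := by
  refine ⟨isFlacet_of_isSplitting hE hZ, ?_⟩
  have h1 := hZ.pos
  have h2 := hZ.lt
  have h3 := hZ.lt_ncard
  have h4 := sep_lt hE hZ.subset (nonempty_of_isSplitting hZ) hZ.ne_ground
  have h5 := M.isRankFunction.le_ncard (M.E \ Z) Set.sdiff_subset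
  have h6 := M.eRank_toNat
  have h7 : ((↑) ⁻¹' Z : Set M.E)ᶜ.ncard = (M.E \ Z).ncard := by
    rw [← ncard_preimage_coe (M := M) (F := M.E \ Z) Set.sdiff_subset, Set.preimage_sdiff,
      Subtype.coe_preimage_self, Set.compl_eq_univ_sdiff]
  have h8 : M.intRk Z = (M.eRk Z).toNat := rfl
  rw [flatHyperplane_eq]
  refine isSplitHyperplane_hypersimplex (by omega) ?_ (by omega) ?_
  · rw [ncard_preimage_coe hZ.subset]; omega
  · rw [h7]; omega

lemma polytope_subset_hypersimplex : M.polytope ⊆ hypersimplex M.eRank.toNat M.E := by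
  intro x hx
  rw [mem_hypersimplex_iff, ← setSum_ground, setSum_ground_eq hx, ← M.eRank_toNat]
  exact ⟨polytope_subset_cube hx, by simp⟩

lemma IsSplitFlacet.isSplitting (hE : RankConn M.intRk ∅ M.E) (hZ : M.IsSplitFlacet Z) :
    IsSplitting M.intRk M.E Z := by
  obtain ⟨⟨⟨⟨hflat, -⟩, -⟩, hfac⟩, hsplit⟩ := hZ
  have hM := M.isRankFunction
  have hss := hflat.subset_ground
  have hpos : 0 < M.intRk Z := by
    refine (hM.nonneg Z).lt_of_ne fun h ↦ hfac.2.1 (face_eq_polytope fun x hx ↦ ?_)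
    have h1 := setSum_le hx Z
    have h2 : 0 ≤ M.setSum Z x := (coordSum_mem_Icc (polytope_subset_cube hx) _).1
    rw [← h] at h1 ⊢
    push_cast at h1 ⊢
    exact h1.antisymm h2
  have hne : Z.Nonempty := by
    by_contra! he
    rw [he, hM.empty] at hpos
    exact hpos.false
  have hlt : M.intRk Z < M.intRk M.E := by
    refine (hM.mono hss).lt_of_ne fun h ↦ hfac.2.1 (face_eq_polytope fun x hx ↦ ?_)
    have h1 : M.Spanning Z := by
      rw [spanning_iff_eRk_le hss, ← eRk_ground, eRk_le_eRk_iff, h]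
    rw [show Z = M.E by rw [← hflat.closure, h1.closure_eq]]
    exact setSum_ground_eq hx
  have hc := rankConn_restrict_of_isFacet hE hss hfac
  have hne' : Z ≠ M.E := by rintro rfl; exact hlt.false
  refine ⟨hss, hpos, hlt, ?_, hc, rankConn_contract_of_isFacet hE hss hfac⟩
  by_contra! hle
  obtain ⟨e, he⟩ := hne
  -- An independent set with connected restriction has at most one element. Then `H(Z)` is `x_e =
  -- 1`, which supports the hypersimplex in a proper face.
  have hZe : Z = {e} := by
    by_contra hZe
    have h1 := hc {e} (Z \ {e}) (by grind) (by grind) (by simp) (Ne.symm hZe)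
    have h2 := hM.le_ncard {e} (by grind)
    have h3 := hM.le_ncard (Z \ {e}) (by grind)
    have h4 := hM.ncard_add_ncard_diff (A := {e}) (B := Z) (by grind) hss
    rw [hM.empty] at h1
    linarith
  have hr : M.intRk Z = 1 := by
    have h1 := hM.le_ncard Z hss
    rw [hZe, Set.ncard_singleton, ← hZe] at h1
    push_cast at h1
    omega
  obtain ⟨B, hB, -, hBlt⟩ := exists_isBase_setSum_lt hE hss ⟨e, he⟩ hne' (Set.empty_subset _)
  refine not_isSplitHyperplane_of_le (f := M.setSum Z) (c := M.intRk Z) (S := affineSpan ℝ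
    (M.flatHyperplane Z ∩ hypersimplex M.eRank.toNat M.E)) ⟨_, Set.toFinite _, rfl⟩ ?_
    (polytope_subset_hypersimplex hB.vec_mem_polytope) hBlt ?_ hsplit
  · intro x hx
    refine (coordSum_mem_Icc (mem_hypersimplex_iff.1 hx).1 _).2.trans ?_
    rw [ncard_preimage_coe hss, hZe, Set.ncard_singleton, ← hZe, hr]
    simp
  · have h1 : affineSpan ℝ (M.flatHyperplane Z ∩ hypersimplex M.eRank.toNat M.E) ≤
        (affineSpan ℝ {(M.intRk Z : ℝ)}).comap (M.setSum Z).toLinearMap.toAffineMap :=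
      affineSpan_le.2 fun x hx ↦ by
        simpa using mem_flatHyperplane.1 hx.1
    intro x hx
    simpa using h1 hx

lemma isSplitFlacet_iff (hM : M.IsConnected) :
    M.IsSplitFlacet Z ↔ IsSplitting M.intRk M.E Z :=
  ⟨fun h ↦ h.isSplitting (M.isConnected_iff_rankConn.1 hM),
    isSplitFlacet_of_isSplitting (M.isConnected_iff_rankConn.1 hM)⟩

/-! ### The relative interior of the slice of the cube -/

lemma mem_affineSpan_polytope (hM : M.IsConnected) {x : M.E → ℝ} :
    x ∈ affineSpan ℝ M.polytope ↔ M.setSum M.E x = M.intRk M.E := by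
  classical
  constructor
  · have h1 : affineSpan ℝ M.polytope ≤
        (affineSpan ℝ {(M.intRk M.E : ℝ)}).comap (M.setSum M.E).toLinearMap.toAffineMap :=
      affineSpan_le.2 fun x hx ↦ by
        simpa using setSum_ground_eq hx
    intro hx
    simpa using h1 hx
  · intro hx
    obtain ⟨B, hB⟩ := M.exists_isBase
    have hp := subset_affineSpan ℝ _ hB.vec_mem_polytope
    have : Fintype M.E := Fintype.ofFinite _
    set y := x - M.vec B with hy
    have hysum : ∑ i, y i = 0 := by
      have h1 : M.setSum M.E y = 0 := by rw [hy, map_sub, hx, hB.setSum_ground_vec, sub_self]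
      rw [setSum_ground, coordSum_apply, finsum_mem_univ, finsum_eq_sum_of_fintype] at h1
      exact h1
    suffices h : y ∈ vectorSpan ℝ M.polytope by
      have h1 := AffineSubspace.vadd_mem_of_mem_direction
        (show y ∈ (affineSpan ℝ M.polytope).direction by rwa [direction_affineSpan]) hp
      simpa [hy] using h1
    rcases isEmpty_or_nonempty M.E with hemp | ⟨⟨j⟩⟩
    · rw [Subsingleton.elim y 0]; exact zero_mem _
    · have h2 : y = ∑ i, y i • (Pi.single i 1 - Pi.single j 1 : M.E → ℝ) := by
        simp_rw [smul_sub, Finset.sum_sub_distrib, ← Finset.sum_smul, hysum, zero_smul, sub_zero]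
        funext k
        simp [Finset.sum_apply, Pi.single_apply]
      rw [h2]
      exact Submodule.sum_mem _ fun i _ ↦ Submodule.smul_mem _ _ (hM.single_sub_single_mem i j)

end Matroid

/-- A relative interior point can be pushed slightly beyond itself, away from any point of the set.
-/
lemma exists_pos_add_smul_mem {V : Type*} [AddCommGroup V] [Module ℝ V] [TopologicalSpace V]
    [IsTopologicalAddGroup V] [ContinuousSMul ℝ V] {S : Set V} {x y : V}
    (hx : x ∈ intrinsicInterior ℝ S) (hy : y ∈ S) :
    ∃ t : ℝ, 0 < t ∧ x + t • (x - y) ∈ S := by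
  obtain ⟨z, hz, rfl⟩ := mem_intrinsicInterior.1 hx
  have hyS := subset_affineSpan ℝ S hy
  let g : ℝ → affineSpan ℝ S := fun t ↦
    ⟨AffineMap.lineMap (z : V) y (-t), AffineMap.lineMap_mem _ z.2 hyS⟩
  have hg : Continuous g := by
    refine Continuous.subtype_mk ?_ _
    simp only [AffineMap.lineMap_apply]
    fun_prop
  have h0 : g 0 = z := by ext; simp [g]
  have h1 : ∀ᶠ t in nhds (0 : ℝ), g t ∈ interior ((↑) ⁻¹' S : Set (affineSpan ℝ S)) :=
    (hg.tendsto' 0 z h0).eventually (isOpen_interior.mem_nhds hz)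
  obtain ⟨ε, hε, hball⟩ := Metric.eventually_nhds_iff.1 h1
  refine ⟨ε / 2, by linarith, ?_⟩
  have h2 := interior_subset (hball (y := ε / 2)
    (by rw [Real.dist_eq, sub_zero, abs_of_pos (by linarith)]; linarith))
  have h3 : (g (ε / 2) : V) = z + (ε / 2) • ((z : V) - y) := by
    simp only [g, AffineMap.lineMap_apply, vsub_eq_sub, vadd_eq_add, neg_smul, ← smul_neg, neg_sub]
    rw [add_comm]
  rw [← h3]
  exact h2

namespace Matroid

variable {α : Type*} {M : Matroid α} [M.Finite] {A B F G I J X Y Z : Set α} {e f : α}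

/-- For a coordinate equal to `0` or `1`, pushing away from a base with the opposite entry leaves
the cube. Nontriviality is essential: on one element the slice is a single point, its own relative
interior, with coordinate `0` or `1`. -/
lemma mem_intrinsicInterior_iff (hM : M.IsConnected) (hnt : M.E.Nontrivial) {x : M.E → ℝ} :
    x ∈ intrinsicInterior ℝ ((affineSpan ℝ M.polytope : Set (M.E → ℝ)) ∩ Set.Icc 0 1) ↔
      (∀ i, 0 < x i ∧ x i < 1) ∧ M.setSum M.E x = M.intRk M.E := by
  have hE := M.isConnected_iff_rankConn.1 hM
  constructor
  · intro hx
    obtain ⟨hxA, hx0, hx1⟩ := intrinsicInterior_subset hx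
    refine ⟨fun i ↦ ?_, (mem_affineSpan_polytope hM).1 hxA⟩
    have hmem : ∀ B, M.IsBase B → M.vec B ∈
        (affineSpan ℝ M.polytope : Set (M.E → ℝ)) ∩ Set.Icc 0 1 := fun B hB ↦
      ⟨subset_affineSpan ℝ _ hB.vec_mem_polytope, polytope_subset_cube hB.vec_mem_polytope⟩
    have hsum : ∀ y : M.E → ℝ, M.setSum {(i : α)} y = y i := fun y ↦ by
      rw [setSum, show ((↑) ⁻¹' {(i : α)} : Set M.E) = {i} by ext; simp [Subtype.coe_inj],
        coordSum_singleton]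
    have hi : ({(i : α)} : Set α) ⊆ M.E := by simp
    have hiE : ({(i : α)} : Set α) ≠ M.E := fun h ↦ by rw [← h] at hnt; simp at hnt
    have hsep := sep_lt hE hi (Set.singleton_nonempty _) hiE
    have hle := M.isRankFunction.mono (show M.E \ {(i : α)} ⊆ M.E from Set.sdiff_subset)
    have hle1 := M.isRankFunction.le_ncard _ hi
    rw [Set.ncard_singleton] at hle1
    constructor
    · refine (hx0 i).lt_of_ne fun h ↦ ?_
      obtain ⟨B, hB, hBi, -⟩ := exists_isBase_of_subset (M := M) subset_rfl hi
      obtain ⟨t, ht, hmt⟩ := exists_pos_add_smul_mem hx (hmem B hB)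
      have h1 := hmt.2.1 i
      rw [hsum] at hBi
      have h2 : (0 : ℝ) < M.intRk {(i : α)} := by
        exact_mod_cast (by linarith : 0 < M.intRk {(i : α)})
      simp only [Pi.add_apply, Pi.smul_apply, Pi.sub_apply, smul_eq_mul, Pi.zero_apply, hBi] at h1 h
      rw [← h] at h1
      nlinarith
    · refine (hx1 i).lt_of_ne fun h ↦ ?_
      obtain ⟨B, hB, -, hBi⟩ := exists_isBase_setSum_lt hE hi (Set.singleton_nonempty _) hiE
        (Set.empty_subset _)
      obtain ⟨t, ht, hmt⟩ := exists_pos_add_smul_mem hx (hmem B hB)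
      have h1 := hmt.2.2 i
      rw [hsum] at hBi
      have h2 : (M.intRk {(i : α)} : ℝ) ≤ 1 := by exact_mod_cast hle1
      simp only [Pi.add_apply, Pi.smul_apply, Pi.sub_apply, smul_eq_mul, Pi.one_apply] at h1 h
      rw [h] at h1
      nlinarith
  · rintro ⟨hx, hxE⟩
    have hxS : x ∈ (affineSpan ℝ M.polytope : Set (M.E → ℝ)) ∩ Set.Icc 0 1 :=
      ⟨(mem_affineSpan_polytope hM).2 hxE, fun i ↦ (hx i).1.le, fun i ↦ (hx i).2.le⟩
    refine mem_intrinsicInterior.2 ⟨⟨x, subset_affineSpan ℝ _ hxS⟩, ?_, rfl⟩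
    rw [mem_interior]
    refine ⟨(↑) ⁻¹' (Set.univ.pi fun _ : M.E ↦ Set.Ioo (0 : ℝ) 1), fun z hz ↦ ⟨?_, ?_⟩, ?_, ?_⟩
    · exact affineSpan_le.2 (Set.inter_subset_left (t := Set.Icc (0 : M.E → ℝ) 1)) z.2
    · exact ⟨fun i ↦ (hz i trivial).1.le, fun i ↦ (hz i trivial).2.le⟩
    · exact (isOpen_set_pi Set.finite_univ fun _ _ ↦ isOpen_Ioo).preimage continuous_subtype_val
    · exact fun i _ ↦ hx i

/-! ### Transfer from rank functions to split matroids -/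

lemma isCommonPoint_iff (hM : M.IsConnected) (hnt : M.E.Nontrivial) (hF : F ⊆ M.E) (hG : G ⊆ M.E)
    (x : α → ℝ) :
    IsCommonPoint M.intRk M.E F G x ↔
      (fun i : M.E ↦ x i) ∈ M.flatHyperplane F ∩ M.flatHyperplane G ∧
      (fun i : M.E ↦ x i) ∈
        intrinsicInterior ℝ ((affineSpan ℝ M.polytope : Set (M.E → ℝ)) ∩ Set.Icc 0 1) := by
  rw [mem_intrinsicInterior_iff hM hnt, Set.mem_inter_iff, mem_flatHyperplane, mem_flatHyperplane,
    setSum_coe x hF, setSum_coe x hG, setSum_coe x subset_rfl, IsCommonPoint]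
  simp only [Subtype.forall]
  tauto

lemma nontrivial_ground_of_isSplitting (hZ : IsSplitting M.intRk M.E Z) : M.E.Nontrivial := by
  obtain ⟨e, he⟩ := nonempty_of_isSplitting hZ
  obtain ⟨f, hf, hfZ⟩ := Set.exists_of_ssubset (hZ.subset.ssubset_of_ne hZ.ne_ground)
  exact ⟨e, hZ.subset he, f, hf, by rintro rfl; exact hfZ he⟩

lemma isCertificate_iff :
    M.IsCertificate Z ↔ IsSplitting M.intRk M.E Z ∧
      (¬ RankUniform M.intRk ∅ Z ∨ ¬ RankUniform M.intRk Z M.E) := by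
  rw [IsCertificate, isSplitting_iff]
  constructor
  · rintro ⟨h1, h2, h3, h4, h5⟩
    rw [isUniform_restrict_iff h1.1.subset_ground, isUniform_contract_iff h1.1.subset_ground] at h5
    exact ⟨⟨h1, h2, h3, h4⟩, h5⟩
  · rintro ⟨⟨h1, h2, h3, h4⟩, h5⟩
    rw [← isUniform_restrict_iff h1.1.subset_ground,
      ← isUniform_contract_iff h1.1.subset_ground] at h5
    exact ⟨h1, h2, h3, h4, h5⟩

lemma isSplit_iff (hM : M.IsConnected) : M.IsSplit ↔ ¬ ∃ Z : Set α, M.IsCertificate Z := by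
  classical
  have hE := M.isConnected_iff_rankConn.1 hM
  have hR := M.isRankFunction
  constructor
  · rintro hs ⟨Z, hZ⟩
    obtain ⟨hZ, hU⟩ := isCertificate_iff.1 hZ
    obtain ⟨F, x, hF, hne, hx⟩ : ∃ F x, IsSplitting M.intRk M.E F ∧ F ≠ Z ∧
        IsCommonPoint M.intRk M.E F Z x := by
      rcases hU with hU | hU
      exacts [hR.exists_commonPoint_of_not_uniform_restrict hE hZ hU,
        hR.exists_commonPoint_of_not_uniform_contract hE hZ hU]
    obtain ⟨h1, h2⟩ :=
      (isCommonPoint_iff hM (nontrivial_ground_of_isSplitting hZ) hF.subset hZ.subset x).1 hx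
    exact hs F Z ((isSplitFlacet_iff hM).2 hF) ((isSplitFlacet_iff hM).2 hZ) hne _ h1 h2
  · intro hcert F₁ F₂ hF₁ hF₂ hne y hy hyint
    rw [isSplitFlacet_iff hM] at hF₁ hF₂
    have hU : ∀ F, IsSplitting M.intRk M.E F →
        RankUniform M.intRk ∅ F ∧ RankUniform M.intRk F M.E := by
      intro F hF
      by_contra h
      exact hcert ⟨F, isCertificate_iff.2 ⟨hF, not_and_or.1 h⟩⟩
    -- The value off the ground set is irrelevant.
    let x : α → ℝ := fun a ↦ if h : a ∈ M.E then y ⟨a, h⟩ else 0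
    have hxy : (fun i : M.E ↦ x i) = y := by funext i; simp [x]
    refine hR.not_isCommonPoint hE hF₁ hF₂ hne (hU _ hF₁).1 (hU _ hF₁).2 (hU _ hF₂).1 x ?_
    rw [isCommonPoint_iff hM (nontrivial_ground_of_isSplitting hF₁) hF₁.subset hF₂.subset, hxy]
    exact ⟨hy, hyint⟩

end Matroid

theorem mainTheorem6 {α : Type*} (M : Matroid α) [M.Finite] (hM : M.IsConnected) :
    (∀ Z : Set α, M.IsSplitFlacet Z ↔
      M.IsProperFlat Z ∧ M.IsCyclic Z ∧ (M ↾ Z).IsConnected ∧ (M ／ Z).IsConnected) ∧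
    (M.IsSplit ↔ ¬ ∃ Z : Set α, M.IsCertificate Z) :=
  ⟨fun _ ↦ (Matroid.isSplitFlacet_iff hM).trans Matroid.isSplitting_iff, Matroid.isSplit_iff hM⟩
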